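/- For each sample size $n$ let $p=p_n$ and $K=K_n$ with $1\le K\le p$, let $\mathbf B_n$ be a real $p\times K$ matrix, and let $\mathbf y=\mathbf B_n\mathbf f+\boldsymbol\varepsilon$ with random vectors $\mathbf f\in\mathbb R^K$ (factors) and $\mathbf y,\boldsymbol\varepsilon\in\mathbb R^p$ (returns and errors); the laws may depend on $n$. Assume: (A) $(\mathbf f_1,\mathbf y_1),\dots,(\mathbf f_n,\mathbf y_n)$ are i.i.d. samples of $(\mathbf f,\mathbf y)$; $E(\boldsymbol\varepsilon\mid\mathbf f)=\mathbf 0$ and $\mathrm{cov}(\boldsymbol\varepsilon\mid\mathbf f)=\Sigma_{n,0}$ is a non-random diagonal matrix; the distribution of $\mathbf f$ is (absolutely) continuous. (B) $E\|\mathbf y\|^2=O(p)$; $\max_{i\le K}E(f_i^4)$ and $\max_{i\le p}E(\varepsilon_i^4)$ are bounded in $n$; and there is $\sigma_1>0$ such that the smallest eigenvalue of $\mathrm{cov}(\mathbf f)$ is at least $\sigma_1$ for all $n$. (C) There is $\sigma_2>0$ such that the smallest eigenvalue of $\Sigma_{n,0}$ is at least $\sigma_2$ for all $n$. Put $\Sigma_n=\mathrm{cov}(\mathbf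 y)$, $\mathbf X=(\mathbf f_1,\dots,\mathbf f_n)$, $\mathbf Y=(\mathbf y_1,\dots,\mathbf y_n)$, let $\mathbf 1$ be a vector of ones, and for a matrix $\mathbf Z$ with $n$ columns let $S(\mathbf Z)=(n-1)^{-1}\mathbf Z\mathbf Z'-\{n(n-1)\}^{-1}\mathbf Z\mathbf 1\mathbf 1'\mathbf Z'$. The factor-model estimator of $\Sigma_n$ is $$\widehat\Sigma_n=\widehat{\mathbf B}\,S(\mathbf X)\,\widehat{\mathbf B}'+\mathrm{diag}\bigl(n^{-1}\widehat{\mathbf E}\widehat{\mathbf E}'\bigr),\qquad \widehat{\mathbf B}=\mathbf Y\mathbf X'(\mathbf X\mathbf X')^{-1},\quad \widehat{\mathbf E}=\mathbf Y-\widehat{\mathbf B}\mathbf X,$$ where $\mathrm{diag}(\cdot)$ keeps only the diagonal entries, and the sample covariance matrix is $\widehat\Sigma_{\mathrm{sam}}=S(\mathbf Y)$. For a $p\times p$ covariance matrix $\Sigma$ let $\boldsymbol\xi_g(\Sigma)=\Sigma^{-1}\mathbf 1/(\mathbf 1'\Sigma^{-1}\mathbf 1)$ be the global minimum variance portfolio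 and $v(\Sigma)=\boldsymbol\xi_g(\Sigma)'\,\Sigma\,\boldsymbol\xi_g(\Sigma)$ its variance. (By convention, the inverse of a singular matrix and the reciprocal of $0$ are read as $0$.) Theorem 5. Suppose that (A)--(C) hold and that $\varphi_n=\mathbf 1'\Sigma_n^{-1}\mathbf 1$ is bounded away from zero. Then, as $n\to\infty$, $$v(\widehat\Sigma_n)-v(\Sigma_n)=o_P\bigl\{(p^4K^4\log n/n)^{1/2}\bigr\},\qquad v(\widehat\Sigma_{\mathrm{sam}})-v(\Sigma_n)=o_P\bigl\{(p^6K^2\log n/n)^{1/2}\bigr\}.$$ -/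

import Mathlib

open MeasureTheory ProbabilityTheory Filter Topology

noncomputable section

namespace FactorCov

/-! ### Population quantities -/

/-- The covariance matrix `cov(Z)` of a random vector `Z` under the law `P`. -/
def covMat {Ω : Type*} [MeasurableSpace Ω] {d : ℕ} (P : Measure Ω) (Z : Ω → Fin d → ℝ) :
    Matrix (Fin d) (Fin d) ℝ :=
  Matrix.of fun i j => covariance (fun ω => Z ω i) (fun ω => Z ω j) P

/-- The returns `y = B f + ε` of the multi-factor model. -/
def returns {Ω : Type*} {p K : ℕ} (B : Matrix (Fin p) (Fin K) ℝ)
    (f : Ω → Fin K → ℝ) (ε : Ω → Fin p → ℝ) : Ω → Fin p → ℝ :=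
  fun ω => B.mulVec (f ω) + ε ω

/-- All eigenvalues of `S` (equivalently its smallest one) are at least `σ`. -/
def EigenvaluesGE {d : ℕ} (S : Matrix (Fin d) (Fin d) ℝ) (σ : ℝ) : Prop :=
  ∀ t : ℝ, Module.End.HasEigenvalue (Matrix.toLin' S) t → σ ≤ t

/-! ### Estimators -/

/-- The matrix whose columns are the sampled vectors `Z 0, …, Z (n - 1)`. -/
def dataMatrix {Ω : Type*} {d n : ℕ} (Z : Fin n → Ω → Fin d → ℝ) (ω : Ω) :
    Matrix (Fin d) (Fin n) ℝ :=
  Matrix.of fun k i => Z i ω k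

/-- The sample covariance matrix `(n-1)⁻¹ Z Z' - {n(n-1)}⁻¹ Z 1 1' Z'` of the columns of `Z`. -/
def sampleCov {d n : ℕ} (Z : Matrix (Fin d) (Fin n) ℝ) : Matrix (Fin d) (Fin d) ℝ :=
  ((n : ℝ) - 1)⁻¹ • (Z * Z.transpose)
    - ((n : ℝ) * ((n : ℝ) - 1))⁻¹ •
        (Z * Matrix.vecMulVec (1 : Fin n → ℝ) (1 : Fin n → ℝ) * Z.transpose)

/-- The least-squares loadings `Y X' (X X')⁻¹`. -/
def loadingsHat {p K n : ℕ} (X : Matrix (Fin K) (Fin n) ℝ) (Y : Matrix (Fin p) (Fin n) ℝ) :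
    Matrix (Fin p) (Fin K) ℝ :=
  Y * X.transpose * (X * X.transpose)⁻¹

/-- The residuals `Y - B̂ X`. -/
def residuals {p K n : ℕ} (X : Matrix (Fin K) (Fin n) ℝ) (Y : Matrix (Fin p) (Fin n) ℝ) :
    Matrix (Fin p) (Fin n) ℝ :=
  Y - loadingsHat X Y * X

/-- The estimated error covariance matrix: the diagonal part of `n⁻¹ Ê Ê'`. -/
def errorCovHat {p K n : ℕ} (X : Matrix (Fin K) (Fin n) ℝ) (Y : Matrix (Fin p) (Fin n) ℝ) :
    Matrix (Fin p) (Fin p) ℝ :=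
  Matrix.diagonal fun i =>
    ((n : ℝ)⁻¹ • (residuals X Y * (residuals X Y).transpose)) i i

/-- The factor-model covariance estimator `Σ̂ = B̂ cov^(f) B̂' + Σ̂₀`. -/
def sigmaHat {p K n : ℕ} (X : Matrix (Fin K) (Fin n) ℝ) (Y : Matrix (Fin p) (Fin n) ℝ) :
    Matrix (Fin p) (Fin p) ℝ :=
  loadingsHat X Y * sampleCov X * (loadingsHat X Y).transpose + errorCovHat X Y

/-! ### Portfolios -/

/-- `φ = 1' S⁻¹ 1`. -/
def phi {p : ℕ} (S : Matrix (Fin p) (Fin p) ℝ) : ℝ :=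
  dotProduct (1 : Fin p → ℝ) (S⁻¹.mulVec 1)

/-- The variance `ξ' S ξ` of the portfolio `ξ` under the covariance matrix `S`. -/
def portfolioVar {p : ℕ} (S : Matrix (Fin p) (Fin p) ℝ) (ξ : Fin p → ℝ) : ℝ :=
  dotProduct ξ (S.mulVec ξ)

/-- The global minimum variance portfolio `ξ_g = (1' S⁻¹ 1)⁻¹ S⁻¹ 1`. -/
def gmvPortfolio {p : ℕ} (S : Matrix (Fin p) (Fin p) ℝ) : Fin p → ℝ :=
  (phi S)⁻¹ • S⁻¹.mulVec 1

/-- The global minimum variance `ξ_g' S ξ_g`. -/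
def globalMinVar {p : ℕ} (S : Matrix (Fin p) (Fin p) ℝ) : ℝ :=
  portfolioVar S (gmvPortfolio S)

/-- Markowitz's mean-variance optimal portfolio with mean vector `μ` and target return `γ`. -/
def markowitz {p : ℕ} (S : Matrix (Fin p) (Fin p) ℝ) (μ : Fin p → ℝ) (γ : ℝ) : Fin p → ℝ :=
  let ψ := dotProduct (1 : Fin p → ℝ) (S⁻¹.mulVec μ)
  let χ := dotProduct μ (S⁻¹.mulVec μ)
  ((χ - γ * ψ) / (phi S * χ - ψ ^ 2)) • S⁻¹.mulVec 1
    + ((γ * phi S - ψ) / (phi S * χ - ψ ^ 2)) • S⁻¹.mulVec μ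

/-- `gmvPortfolio` is Markowitz's portfolio at the target return `γ = ψ / φ`, whenever the
latter formula makes sense. -/
theorem markowitz_eq_gmvPortfolio {p : ℕ} (S : Matrix (Fin p) (Fin p) ℝ) (μ : Fin p → ℝ)
    (h0 : phi S ≠ 0)
    (h1 : phi S * dotProduct μ (S⁻¹.mulVec μ)
      - dotProduct (1 : Fin p → ℝ) (S⁻¹.mulVec μ) ^ 2 ≠ 0) :
    markowitz S μ (dotProduct (1 : Fin p → ℝ) (S⁻¹.mulVec μ) / phi S) = gmvPortfolio S := by
  unfold markowitz gmvPortfolio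
  simp only
  rw [div_mul_cancel₀ _ h0, sub_self, zero_div, zero_smul, add_zero]
  congr 1
  rw [div_eq_iff h1]
  field_simp

/-- For positive definite `S`, `gmvPortfolio S` is fully invested and minimizes the variance among
all fully invested portfolios. -/
theorem gmvPortfolio_optimal {p : ℕ} [NeZero p] (S : Matrix (Fin p) (Fin p) ℝ) (hS : S.PosDef) :
    dotProduct (gmvPortfolio S) 1 = 1 ∧
      ∀ ξ : Fin p → ℝ, dotProduct ξ 1 = 1 → globalMinVar S ≤ portfolioVar S ξ := by
  have hdet : IsUnit S.det := hS.det_pos.ne'.isUnit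
  have h1 : (1 : Fin p → ℝ) ≠ 0 := one_ne_zero
  have hphi : 0 < phi S := by
    have := hS.inv.dotProduct_mulVec_pos h1
    simpa [phi] using this
  have hb : dotProduct (gmvPortfolio S) 1 = 1 := by
    rw [gmvPortfolio, smul_dotProduct, dotProduct_comm, ← phi, smul_eq_mul,
      inv_mul_cancel₀ hphi.ne']
  have hSg : S.mulVec (gmvPortfolio S) = (phi S)⁻¹ • (1 : Fin p → ℝ) := by
    rw [gmvPortfolio, Matrix.mulVec_smul, Matrix.mulVec_mulVec, Matrix.mul_nonsing_inv _ hdet,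
      Matrix.one_mulVec]
  refine ⟨hb, fun ξ hξ => ?_⟩
  have hsym : S.transpose = S := by simpa using hS.isHermitian.eq
  have hcross : ∀ η : Fin p → ℝ, dotProduct (gmvPortfolio S) (S.mulVec η)
      = (phi S)⁻¹ * dotProduct η 1 := by
    intro η
    rw [Matrix.dotProduct_mulVec, ← Matrix.mulVec_transpose, hsym, hSg, smul_dotProduct,
      dotProduct_comm, smul_eq_mul]
  have h := hS.posSemidef.dotProduct_mulVec_nonneg (ξ - gmvPortfolio S)
  simp only [star_trivial, Matrix.mulVec_sub, sub_dotProduct, dotProduct_sub, hcross, hξ, hb] at h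
  rw [hSg, dotProduct_smul, hξ] at h
  rw [globalMinVar, portfolioVar, portfolioVar, hcross, hb]
  simp only [smul_eq_mul] at h
  linarith

/-! ### Stochastic order and assumptions -/

/-- `Z n = o_P(r n)`, where `Z n` lives on its own probability space `(Ω n, P n)`. -/
def IsLittleOP {Ω : ℕ → Type*} [∀ n, MeasurableSpace (Ω n)] (P : ∀ n, Measure (Ω n))
    (Z : ∀ n, Ω n → ℝ) (r : ℕ → ℝ) : Prop :=
  ∀ δ : ℝ, 0 < δ → Tendsto (fun n => P n {ω | δ * r n < |Z n ω|}) atTop (𝓝 0)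

/-- Condition (A) at sample size `n`, with generic factors `f`, generic errors `ε`, generic returns
`y = B f + ε`, samples `(F i, Y i)` of `(f, y)`, and conditional error covariance `S0`. -/
structure ConditionA {Ω : Type*} [MeasurableSpace Ω] (P : Measure Ω) (n p K : ℕ)
    (B : Matrix (Fin p) (Fin K) ℝ) (S0 : Matrix (Fin p) (Fin p) ℝ)
    (f : Ω → Fin K → ℝ) (ε : Ω → Fin p → ℝ)
    (F : Fin n → Ω → Fin K → ℝ) (Y : Fin n → Ω → Fin p → ℝ) : Prop where
  measurable_factors : Measurable f
  measurable_errors : Measurable ε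
  measurable_sample : ∀ i, Measurable fun ω => (F i ω, Y i ω)
  indep : iIndepFun (fun i ω => (F i ω, Y i ω)) P
  identDistrib : ∀ i, IdentDistrib (fun ω => (F i ω, Y i ω)) (fun ω => (f ω, returns B f ε ω)) P P
  /-- The errors have finite second moments, so that the conditional moments make sense. -/
  memLp_errors : ∀ i, MemLp (fun ω => ε ω i) 2 P
  condMean : ∀ i, P[fun ω => ε ω i | MeasurableSpace.comap f inferInstance] =ᵐ[P] fun _ => 0
  /-- As `E(ε | f) = 0`, the conditional covariance is the conditional second moment. -/
  condCov : ∀ i j,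
    P[fun ω => ε ω i * ε ω j | MeasurableSpace.comap f inferInstance] =ᵐ[P] fun _ => S0 i j
  diag : S0.IsDiag
  /-- The factors have a continuous distribution, that is, a Lebesgue density. -/
  continuous_factors : P.map f ≪ (volume : Measure (Fin K → ℝ))
  K_le_p : K ≤ p

/-- Condition (B) for the sequence of models. -/
structure ConditionB {Ω : ℕ → Type*} [∀ n, MeasurableSpace (Ω n)] (P : ∀ n, Measure (Ω n))
    (p K : ℕ → ℕ) (B : ∀ n, Matrix (Fin (p n)) (Fin (K n)) ℝ)
    (f : ∀ n, Ω n → Fin (K n) → ℝ) (ε : ∀ n, Ω n → Fin (p n) → ℝ) : Prop where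
  /-- `b_n = E‖y‖² = O(p)`. -/
  returns_moment : ∃ C : ℝ, ∀ n,
    Integrable (fun ω => ∑ i, returns (B n) (f n) (ε n) ω i ^ 2) (P n) ∧
      ∫ ω, ∑ i, returns (B n) (f n) (ε n) ω i ^ 2 ∂(P n) ≤ C * p n
  /-- `c_n = max_i E(f_i⁴)` is bounded. -/
  factors_moment : ∃ C : ℝ, ∀ n i,
    Integrable (fun ω => f n ω i ^ 4) (P n) ∧ ∫ ω, f n ω i ^ 4 ∂(P n) ≤ C
  /-- `d_n = max_i E(ε_i⁴)` is bounded. -/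
  errors_moment : ∃ C : ℝ, ∀ n i,
    Integrable (fun ω => ε n ω i ^ 4) (P n) ∧ ∫ ω, ε n ω i ^ 4 ∂(P n) ≤ C
  /-- `λ_K(cov f) ≥ σ₁ > 0`. -/
  factors_cov : ∃ σ₁ : ℝ, 0 < σ₁ ∧ ∀ n, EigenvaluesGE (covMat (P n) (f n)) σ₁

/-- Condition (C): `λ_p(Σ₀) ≥ σ₂ > 0`. -/
def ConditionC (p : ℕ → ℕ) (S0 : ∀ n, Matrix (Fin (p n)) (Fin (p n)) ℝ) : Prop :=
  ∃ σ₂ : ℝ, 0 < σ₂ ∧ ∀ n, EigenvaluesGE (S0 n) σ₂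

end FactorCov

end

namespace FactorCov

section FrobeniusNorm

attribute [local instance] Matrix.frobeniusNormedAddCommGroup Matrix.frobeniusNormedSpace

/-! ### Quadratic forms and the Frobenius norm -/

/-! The minimum variance is the minimum of `ξ'Sξ` over fully invested `ξ`. Testing the optimal
portfolio of each of two matrices against the other bounds the difference of their minimum variances
by the Frobenius distance times the squared length of a portfolio. That length is controlled by `φ ≥
c` and by the eigenvalue bound `σ₂`, which `Σ_n` inherits from the error covariance. So
`globalMinVar` is Lipschitz near `Σ_n` with a constant independent of `n`, `p` and `K`
(`abs_globalMinVar_sub_le`), and Frobenius rates for the two covariance estimators are enough.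

These rates come from Chebyshev's inequality for averages of i.i.d. matrices
(`measureReal_norm_average_sub_gt_le`), the only concentration tool. For the sample covariance the
fourth moment `E‖y‖⁴` is needed. It follows from `‖B‖² = O(p)`, which is forced by `E‖y‖² = O(p)`
and `cov(f) ≥ σ₁`. For the factor estimator, a deterministic expansion (`norm_sigmaHat_sub_le`)
reduces the error to three averages: the factor covariance, the error-factor products and the
error-error products.

Nothing makes the claimed rate tend to zero, and the Lipschitz bound is only local. When the rate is
not small, tightness takes over. The minimum variance is at most that of equal weights, hence at
most `‖T‖ / p`, and both estimators satisfy `‖T‖ ≤ 3 n⁻¹ ‖Y‖²`, because least squares and centring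
are projections. The mean of `n⁻¹ ‖Y‖² / p` is bounded (`measureReal_globalMinVar_sub`).
`isLittleOP_of_rate` combines the two regimes; the factor `√(log n)` leaves a diverging margin in
each. -/

theorem frobenius_norm_sq {m n : Type*} [Fintype m] [Fintype n] (A : Matrix m n ℝ) :
    ‖A‖ ^ 2 = ∑ i, ∑ j, A i j ^ 2 := by
  rw [Matrix.frobenius_norm_def, ← Real.sqrt_eq_rpow, Real.sq_sqrt (by positivity)]
  simp

/-- Cauchy–Schwarz over index pairs, pairing `M` with `xx'`, whose Frobenius norm is `x ⬝ᵥ x`. -/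
theorem abs_dotProduct_mulVec_le {d : ℕ} (M : Matrix (Fin d) (Fin d) ℝ) (x : Fin d → ℝ) :
    |x ⬝ᵥ M.mulVec x| ≤ ‖M‖ * (x ⬝ᵥ x) := by
  have hx : 0 ≤ x ⬝ᵥ x := Finset.sum_nonneg fun i _ => mul_self_nonneg _
  apply abs_le_of_sq_le_sq _ (by positivity)
  have h := Finset.sum_mul_sq_le_sq_mul_sq (Finset.univ : Finset (Fin d × Fin d))
    (fun q => M q.1 q.2) (fun q => x q.1 * x q.2)
  simp only [Fintype.sum_prod_type] at h
  have e1 : ∑ i, ∑ j, M i j * (x i * x j) = x ⬝ᵥ M.mulVec x := by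
    simp only [dotProduct, Matrix.mulVec, Finset.mul_sum]
    exact Finset.sum_congr rfl fun i _ => Finset.sum_congr rfl fun j _ => by ring
  have e2 : ∑ i, ∑ j, (x i * x j) ^ 2 = (x ⬝ᵥ x) ^ 2 := by
    rw [sq (x ⬝ᵥ x)]
    simp only [dotProduct, Finset.sum_mul_sum]
    exact Finset.sum_congr rfl fun i _ => Finset.sum_congr rfl fun j _ => by ring
  rw [e1, e2, ← frobenius_norm_sq] at h
  rw [mul_pow]
  exact h

/-- The quadratic form of `S` is at least `σ` times the squared Euclidean norm. -/
def QuadGE {d : ℕ} (S : Matrix (Fin d) (Fin d) ℝ) (σ : ℝ) : Prop :=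
  ∀ x : Fin d → ℝ, σ * (x ⬝ᵥ x) ≤ x ⬝ᵥ S.mulVec x

/-- An eigenvalue of the symmetric matrix `S - σ` becomes one of `S` when `σ` is added, so all
eigenvalues of `S - σ` are nonnegative and the spectral theorem makes it positive semidefinite. -/
theorem EigenvaluesGE.quadGE {d : ℕ} {S : Matrix (Fin d) (Fin d) ℝ} {σ : ℝ}
    (hS : S.IsHermitian) (h : EigenvaluesGE S σ) : QuadGE S σ := by
  have hT : (S - σ • (1 : Matrix (Fin d) (Fin d) ℝ)).IsHermitian :=
    hS.sub (by simp [Matrix.IsHermitian])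
  have hpos : (S - σ • (1 : Matrix (Fin d) (Fin d) ℝ)).PosSemidef := by
    rw [hT.posSemidef_iff_eigenvalues_nonneg]
    intro i
    have hv := hT.mulVec_eigenvectorBasis i
    have hne : (⇑(hT.eigenvectorBasis i) : Fin d → ℝ) ≠ 0 := by
      intro h0
      apply hT.eigenvectorBasis.toBasis.ne_zero i
      ext j
      simpa using congrFun h0 j
    have := h (hT.eigenvalues i + σ) (Module.End.hasEigenvalue_of_hasEigenvector
      (x := (⇑(hT.eigenvectorBasis i) : Fin d → ℝ)) ⟨by
        rw [Module.End.mem_eigenspace_iff, Matrix.toLin'_apply]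
        rw [Matrix.sub_mulVec, Matrix.smul_mulVec, Matrix.one_mulVec, sub_eq_iff_eq_add] at hv
        rw [hv, add_smul], hne⟩)
    simpa using this
  intro x
  have := hpos.dotProduct_mulVec_nonneg x
  rw [Matrix.sub_mulVec, dotProduct_sub, Matrix.smul_mulVec, Matrix.one_mulVec,
    dotProduct_smul, star_trivial, smul_eq_mul] at this
  linarith

theorem QuadGE.posDef {d : ℕ} {S : Matrix (Fin d) (Fin d) ℝ} {σ : ℝ} (h : QuadGE S σ)
    (hσ : 0 < σ) (hS : S.IsHermitian) : S.PosDef := by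
  refine Matrix.PosDef.of_dotProduct_mulVec_pos hS fun x hx => ?_
  rw [star_trivial]
  have : 0 < x ⬝ᵥ x := by
    simpa using Matrix.dotProduct_star_self_pos_iff.2 hx
  exact lt_of_lt_of_le (by positivity) (h x)

theorem QuadGE.of_norm_sub_le {d : ℕ} {S T : Matrix (Fin d) (Fin d) ℝ} {σ η : ℝ} (h : QuadGE S σ)
    (hη : ‖T - S‖ ≤ η) : QuadGE T (σ - η) := by
  intro x
  have hx : 0 ≤ x ⬝ᵥ x := Finset.sum_nonneg fun i _ => mul_self_nonneg _
  have h1 := abs_le.1 (abs_dotProduct_mulVec_le (T - S) x)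
  rw [Matrix.sub_mulVec, dotProduct_sub] at h1
  nlinarith [h x, mul_le_mul_of_nonneg_right hη hx]

/-! ### The global minimum variance -/

theorem globalMinVar_eq_inv_phi {p : ℕ} (S : Matrix (Fin p) (Fin p) ℝ) (hS : IsUnit S.det) :
    globalMinVar S = (phi S)⁻¹ := by
  have hSg : S.mulVec (gmvPortfolio S) = (phi S)⁻¹ • (1 : Fin p → ℝ) := by
    rw [gmvPortfolio, Matrix.mulVec_smul, Matrix.mulVec_mulVec, Matrix.mul_nonsing_inv _ hS,
      Matrix.one_mulVec]
  rw [globalMinVar, portfolioVar, hSg, gmvPortfolio, dotProduct_smul, smul_dotProduct,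
    dotProduct_comm, ← phi, smul_eq_mul, smul_eq_mul]
  by_cases h : phi S = 0
  · simp [h]
  · field_simp

/-- An estimated covariance matrix can be singular; the convention for inverses then makes the
portfolio zero, which keeps the tightness bound valid. -/
theorem globalMinVar_of_not_isUnit {p : ℕ} (S : Matrix (Fin p) (Fin p) ℝ) (hS : ¬ IsUnit S.det) :
    globalMinVar S = 0 := by
  have : gmvPortfolio S = 0 := by
    rw [gmvPortfolio, Matrix.nonsing_inv_apply_not_isUnit S hS, Matrix.zero_mulVec, smul_zero]
  rw [globalMinVar, this, portfolioVar, zero_dotProduct]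

theorem globalMinVar_nonneg {p : ℕ} {S : Matrix (Fin p) (Fin p) ℝ} (hS : S.PosSemidef) :
    0 ≤ globalMinVar S := by
  simpa [globalMinVar, portfolioVar] using hS.dotProduct_mulVec_nonneg (gmvPortfolio S)

/-- The minimum variance is at most that of the equally weighted portfolio. -/
theorem globalMinVar_le_norm_div {p : ℕ} [NeZero p] {S : Matrix (Fin p) (Fin p) ℝ}
    (hS : S.PosSemidef) : globalMinVar S ≤ ‖S‖ / p := by
  have hp : (p : ℝ) ≠ 0 := Nat.cast_ne_zero.2 (NeZero.ne p)
  by_cases hu : IsUnit S.det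
  · have hpd : S.PosDef := hS.posDef_iff_isUnit.2 ((Matrix.isUnit_iff_isUnit_det S).2 hu)
    let ξ : Fin p → ℝ := fun _ => (p : ℝ)⁻¹
    have h1 : ξ ⬝ᵥ 1 = 1 := by simp [ξ, dotProduct, hp]
    have h2 : ξ ⬝ᵥ ξ = (p : ℝ)⁻¹ := by simp [ξ, dotProduct, hp]
    refine ((gmvPortfolio_optimal S hpd).2 ξ h1).trans ((le_abs_self _).trans ?_)
    exact (abs_dotProduct_mulVec_le S ξ).trans_eq (by rw [h2, div_eq_mul_inv])
  · rw [globalMinVar_of_not_isUnit S hu]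
    positivity

/-- Lipschitz dependence of the global minimum variance on the covariance matrix. -/
theorem abs_globalMinVar_sub_le {p : ℕ} [NeZero p] {S T : Matrix (Fin p) (Fin p) ℝ} {σ c η : ℝ}
    (hσ : 0 < σ) (hc : 0 < c) (hS : S.IsHermitian) (hT : T.IsHermitian) (hSσ : QuadGE S σ)
    (hφ : c ≤ phi S) (hη : ‖T - S‖ ≤ η) (hησ : η ≤ σ / 2) :
    |globalMinVar T - globalMinVar S| ≤ 3 / (c * σ) * η := by
  have hη0 : 0 ≤ η := (norm_nonneg _).trans hη
  have hTσ : QuadGE T (σ / 2) := by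
    intro x
    have hx : 0 ≤ x ⬝ᵥ x := Finset.sum_nonneg fun i _ => mul_self_nonneg _
    have := hSσ.of_norm_sub_le hη x
    nlinarith
  have hSp := hSσ.posDef hσ hS
  have hTp := hTσ.posDef (by positivity) hT
  have hv : globalMinVar S ≤ 1 / c := by
    rw [globalMinVar_eq_inv_phi S hSp.det_pos.ne'.isUnit, ← one_div]
    exact one_div_le_one_div_of_le hc hφ
  obtain ⟨hS1, hS2⟩ := gmvPortfolio_optimal S hSp
  obtain ⟨hT1, hT2⟩ := gmvPortfolio_optimal T hTp
  have key : ∀ ξ : Fin p → ℝ, |portfolioVar T ξ - portfolioVar S ξ| ≤ η * (ξ ⬝ᵥ ξ) := by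
    intro ξ
    have hx : 0 ≤ ξ ⬝ᵥ ξ := Finset.sum_nonneg fun i _ => mul_self_nonneg _
    have h := abs_dotProduct_mulVec_le (T - S) ξ
    rw [Matrix.sub_mulVec, dotProduct_sub] at h
    exact h.trans (mul_le_mul_of_nonneg_right hη hx)
  set g := gmvPortfolio S with hg
  set k := gmvPortfolio T with hk
  -- The length of an optimal portfolio is at most its variance divided by the lower bound of the
  -- form; here the variance is `1 / φ ≤ 1 / c`.
  have hgg : g ⬝ᵥ g ≤ 1 / (c * σ) := by
    have := hSσ g
    change σ * (g ⬝ᵥ g) ≤ globalMinVar S at this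
    rw [le_div_iff₀ (by positivity)]
    rw [le_div_iff₀ hc] at hv
    nlinarith
  have h1 : globalMinVar T ≤ globalMinVar S + η * (1 / (c * σ)) := by
    have h := (abs_le.1 (key g)).2
    have h' := hT2 g hS1
    have : η * (g ⬝ᵥ g) ≤ η * (1 / (c * σ)) := mul_le_mul_of_nonneg_left hgg hη0
    change portfolioVar T g - globalMinVar S ≤ _ at h
    linarith
  -- With `η ≤ σ / 2` the variance under `T` is at most `1/c + 1/(2c) = 3/(2c)`. Dividing by the
  -- halved bound `σ / 2` gives the constant 3 for the other portfolio.
  have hη2 : η * (1 / (c * σ)) ≤ 1 / (2 * c) := by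
    rw [mul_one_div, div_le_div_iff₀ (by positivity) (by positivity)]
    nlinarith
  have hkk : k ⬝ᵥ k ≤ 3 / (c * σ) := by
    have := hTσ k
    change σ / 2 * (k ⬝ᵥ k) ≤ globalMinVar T at this
    have h3 : σ / 2 * (k ⬝ᵥ k) ≤ 3 / (2 * c) := by
      have : 1 / c + 1 / (2 * c) = 3 / (2 * c) := by field_simp; norm_num
      linarith
    rw [le_div_iff₀ (by positivity)] at h3 ⊢
    nlinarith
  have h2 : globalMinVar S ≤ globalMinVar T + η * (3 / (c * σ)) := by
    have h := (abs_le.1 (key k)).1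
    have h' := hS2 k hT1
    have : η * (k ⬝ᵥ k) ≤ η * (3 / (c * σ)) := mul_le_mul_of_nonneg_left hkk hη0
    change _ ≤ globalMinVar T - portfolioVar S k at h
    linarith
  have h13 : η * (1 / (c * σ)) ≤ η * (3 / (c * σ)) := by gcongr; norm_num
  rw [abs_le]
  constructor <;> nlinarith

/-! ### Sample covariance matrices -/

/-- The column of sample means. -/
noncomputable def sampleMean {d n : ℕ} (Z : Matrix (Fin d) (Fin n) ℝ) : Matrix (Fin d) Unit ℝ :=
  (n : ℝ)⁻¹ • (Z * (Matrix.replicateCol Unit 1 : Matrix (Fin n) Unit ℝ))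

theorem vecMulVec_one_one {n : ℕ} : Matrix.vecMulVec (1 : Fin n → ℝ) (1 : Fin n → ℝ)
    = (Matrix.replicateCol Unit 1 : Matrix (Fin n) Unit ℝ) *
        (Matrix.replicateCol Unit 1 : Matrix (Fin n) Unit ℝ).transpose := by
  ext i j
  simp [Matrix.vecMulVec_apply, Matrix.mul_apply]

theorem sampleCov_eq {d n : ℕ} (hn : 2 ≤ n) (Z : Matrix (Fin d) (Fin n) ℝ) :
    sampleCov Z = ((n : ℝ) / (n - 1)) •
      ((n : ℝ)⁻¹ • (Z * Z.transpose) - sampleMean Z * (sampleMean Z).transpose) := by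
  have h2 : (2 : ℝ) ≤ n := by exact_mod_cast hn
  have h0 : (n : ℝ) ≠ 0 := by linarith
  have h1 : (n : ℝ) - 1 ≠ 0 := by linarith
  rw [sampleCov, vecMulVec_one_one, sampleMean, Matrix.transpose_smul, Matrix.transpose_mul,
    Matrix.smul_mul, Matrix.mul_smul, smul_sub, smul_smul, smul_smul, smul_smul, Matrix.mul_assoc,
    Matrix.mul_assoc, Matrix.mul_assoc]
  congr 2 <;> field_simp

theorem sampleCov_isHermitian {d n : ℕ} (Z : Matrix (Fin d) (Fin n) ℝ) :
    (sampleCov Z).IsHermitian := by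
  rw [Matrix.IsHermitian, Matrix.conjTranspose_eq_transpose_of_trivial, sampleCov,
    vecMulVec_one_one]
  simp only [Matrix.transpose_sub, Matrix.transpose_smul, Matrix.transpose_mul,
    Matrix.transpose_transpose, Matrix.mul_assoc]

/-- The centring projection. -/
noncomputable def centering (n : ℕ) : Matrix (Fin n) (Fin n) ℝ :=
  1 - (n : ℝ)⁻¹ • Matrix.vecMulVec (1 : Fin n → ℝ) (1 : Fin n → ℝ)

/-- Since centring is a symmetric idempotent, this form yields both positive semidefiniteness and a
norm bound. -/
theorem sampleCov_eq_centering {d n : ℕ} (Z : Matrix (Fin d) (Fin n) ℝ) :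
    sampleCov Z = ((n : ℝ) - 1)⁻¹ • (Z * centering n * Z.transpose) := by
  rw [sampleCov, centering, Matrix.mul_sub, Matrix.sub_mul, smul_sub, Matrix.mul_one,
    Matrix.mul_smul, Matrix.smul_mul, smul_smul, mul_inv, mul_comm (n : ℝ)⁻¹]

theorem centering_transpose (n : ℕ) : (centering n).transpose = centering n := by
  rw [centering, vecMulVec_one_one]
  simp only [Matrix.transpose_sub, Matrix.transpose_smul, Matrix.transpose_mul,
    Matrix.transpose_transpose, Matrix.transpose_one]

theorem centering_mul_self (n : ℕ) : centering n * centering n = centering n := by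
  rcases Nat.eq_zero_or_pos n with rfl | hn
  · exact Subsingleton.elim _ _
  have h0 : (n : ℝ) ≠ 0 := by positivity
  have hJ : Matrix.vecMulVec (1 : Fin n → ℝ) (1 : Fin n → ℝ) * Matrix.vecMulVec 1 1
      = (n : ℝ) • Matrix.vecMulVec (1 : Fin n → ℝ) (1 : Fin n → ℝ) := by
    ext i j
    simp [Matrix.mul_apply]
  rw [centering, Matrix.sub_mul, Matrix.one_mul, Matrix.smul_mul, Matrix.mul_sub, Matrix.mul_one,
    Matrix.mul_smul, hJ, smul_smul, inv_mul_cancel₀ h0, one_smul, sub_self, smul_zero, sub_zero]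

theorem sampleCov_posSemidef {d n : ℕ} (hn : 1 ≤ n) (Z : Matrix (Fin d) (Fin n) ℝ) :
    (sampleCov Z).PosSemidef := by
  have h1 : (0 : ℝ) ≤ ((n : ℝ) - 1)⁻¹ := by
    have : (1 : ℝ) ≤ n := by exact_mod_cast hn
    exact inv_nonneg.2 (by linarith)
  have h := Matrix.posSemidef_self_mul_conjTranspose (Z * centering n)
  rw [Matrix.conjTranspose_eq_transpose_of_trivial, Matrix.transpose_mul, centering_transpose,
    ← Matrix.mul_assoc, Matrix.mul_assoc Z, centering_mul_self] at h
  rw [sampleCov_eq_centering]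
  exact h.smul h1

/-- Multiplying by a symmetric idempotent does not increase the Frobenius norm. -/
theorem norm_mul_le_of_projection {d n : ℕ} (Y : Matrix (Fin d) (Fin n) ℝ)
    {H : Matrix (Fin n) (Fin n) ℝ} (hH : H.transpose = H) (hHH : H * H = H) :
    ‖Y * H‖ ≤ ‖Y‖ := by
  have htr : ∀ Z : Matrix (Fin d) (Fin n) ℝ, ‖Z‖ ^ 2 = (Z * Z.transpose).trace := by
    intro Z
    rw [frobenius_norm_sq]
    simp [Matrix.trace, Matrix.mul_apply, sq]
  apply le_of_sq_le_sq _ (norm_nonneg _)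
  -- Pythagoras: the rows of `Y * H` are orthogonal to those of `Y - Y * H` in the trace inner
  -- product.
  have h1 : ‖Y‖ ^ 2 = ‖Y * H‖ ^ 2 + ‖Y - Y * H‖ ^ 2 := by
    have a : Y * H * (Y * H).transpose = Y * H * Y.transpose := by
      rw [Matrix.transpose_mul, hH, ← Matrix.mul_assoc, Matrix.mul_assoc Y, hHH]
    have b : Y * (Y * H).transpose = Y * H * Y.transpose := by
      rw [Matrix.transpose_mul, hH, ← Matrix.mul_assoc]
    rw [htr, htr, htr, Matrix.transpose_sub, Matrix.sub_mul, Matrix.mul_sub, Matrix.mul_sub, a, b,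
      sub_self, sub_zero, Matrix.trace_sub]
    ring
  nlinarith [sq_nonneg ‖Y - Y * H‖]

theorem norm_sampleCov_le {d n : ℕ} (hn : 2 ≤ n) (Z : Matrix (Fin d) (Fin n) ℝ) :
    ‖sampleCov Z‖ ≤ ((n : ℝ) - 1)⁻¹ * ‖Z‖ ^ 2 := by
  have h2 : (2 : ℝ) ≤ n := by exact_mod_cast hn
  have h1 : (0 : ℝ) ≤ ((n : ℝ) - 1)⁻¹ := inv_nonneg.2 (by linarith)
  rw [sampleCov_eq_centering, norm_smul, Real.norm_of_nonneg h1]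
  gcongr
  refine (Matrix.frobenius_norm_mul _ _).trans ?_
  rw [Matrix.frobenius_norm_transpose, sq]
  gcongr
  exact norm_mul_le_of_projection Z (centering_transpose n) (centering_mul_self n)

/-! ### The factor-model estimator -/

theorem errorCovHat_posSemidef {p K n : ℕ} (X : Matrix (Fin K) (Fin n) ℝ)
    (Y : Matrix (Fin p) (Fin n) ℝ) : (errorCovHat X Y).PosSemidef := by
  refine Matrix.PosSemidef.diagonal fun i => ?_
  simp only [Pi.zero_apply, Matrix.smul_apply, Matrix.mul_apply, Matrix.transpose_apply,
    smul_eq_mul]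
  exact mul_nonneg (by positivity) (Finset.sum_nonneg fun j _ => mul_self_nonneg _)

theorem sigmaHat_posSemidef {p K n : ℕ} (hn : 1 ≤ n) (X : Matrix (Fin K) (Fin n) ℝ)
    (Y : Matrix (Fin p) (Fin n) ℝ) : (sigmaHat X Y).PosSemidef := by
  refine Matrix.PosSemidef.add ?_ (errorCovHat_posSemidef X Y)
  simpa using (sampleCov_posSemidef hn X).mul_mul_conjTranspose_same (loadingsHat X Y)

theorem norm_diagonal_diag_le {d : ℕ} (M : Matrix (Fin d) (Fin d) ℝ) :
    ‖Matrix.diagonal fun i => M i i‖ ≤ ‖M‖ := by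
  apply le_of_sq_le_sq _ (norm_nonneg _)
  rw [frobenius_norm_sq, frobenius_norm_sq]
  refine Finset.sum_le_sum fun i _ => Finset.sum_le_sum fun j _ => ?_
  by_cases h : i = j
  · subst h; simp
  · simp [h, sq_nonneg]

/-- The hat matrix `X' (X X')⁻¹ X`. -/
noncomputable def hatMatrix {K n : ℕ} (X : Matrix (Fin K) (Fin n) ℝ) : Matrix (Fin n) (Fin n) ℝ :=
  X.transpose * (X * X.transpose)⁻¹ * X

theorem hatMatrix_transpose {K n : ℕ} (X : Matrix (Fin K) (Fin n) ℝ) :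
    (hatMatrix X).transpose = hatMatrix X := by
  simp [hatMatrix, Matrix.transpose_mul, Matrix.transpose_nonsing_inv, Matrix.mul_assoc]

/-- Idempotency survives a singular `X X'`, because the inverse is then zero and so is the hat
matrix. -/
theorem hatMatrix_mul_self {K n : ℕ} (X : Matrix (Fin K) (Fin n) ℝ) :
    hatMatrix X * hatMatrix X = hatMatrix X := by
  have h : (X * X.transpose)⁻¹ * (X * X.transpose) * (X * X.transpose)⁻¹
      = (X * X.transpose)⁻¹ := by
    by_cases hu : IsUnit (X * X.transpose).det
    · rw [Matrix.nonsing_inv_mul _ hu, Matrix.one_mul]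
    · rw [Matrix.nonsing_inv_apply_not_isUnit _ hu, Matrix.mul_zero]
  calc hatMatrix X * hatMatrix X
      = X.transpose * ((X * X.transpose)⁻¹ * (X * X.transpose) * (X * X.transpose)⁻¹) * X := by
        simp only [hatMatrix, Matrix.mul_assoc]
    _ = hatMatrix X := by rw [h, hatMatrix]

/-- With `H` the hat matrix, `B̂ X = Y H`, so the factor part of the estimator is the sample
covariance of `Y H`, while the residuals are `Y (1 - H)`. Both are projections of `Y`. The bound
holds for every sample, with no invertibility needed, as tightness requires. -/
theorem norm_sigmaHat_le {p K n : ℕ} (hn : 2 ≤ n) (X : Matrix (Fin K) (Fin n) ℝ)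
    (Y : Matrix (Fin p) (Fin n) ℝ) :
    ‖sigmaHat X Y‖ ≤ (((n : ℝ) - 1)⁻¹ + (n : ℝ)⁻¹) * ‖Y‖ ^ 2 := by
  have h2 : (2 : ℝ) ≤ n := by exact_mod_cast hn
  have h1 : (0 : ℝ) ≤ ((n : ℝ) - 1)⁻¹ := inv_nonneg.2 (by linarith)
  have hBX : loadingsHat X Y * X = Y * hatMatrix X := by
    simp only [loadingsHat, hatMatrix, Matrix.mul_assoc]
  have e1 : loadingsHat X Y * sampleCov X * (loadingsHat X Y).transpose
      = sampleCov (Y * hatMatrix X) := by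
    rw [← hBX, sampleCov_eq_centering, sampleCov_eq_centering, Matrix.mul_smul, Matrix.smul_mul,
      Matrix.transpose_mul]
    simp only [Matrix.mul_assoc]
  have hP := norm_mul_le_of_projection Y (hatMatrix_transpose X) (hatMatrix_mul_self X)
  have hQ : ‖residuals X Y‖ ≤ ‖Y‖ := by
    have h3 : (1 - hatMatrix X).transpose = 1 - hatMatrix X := by
      rw [Matrix.transpose_sub, hatMatrix_transpose, Matrix.transpose_one]
    have h4 : (1 - hatMatrix X) * (1 - hatMatrix X) = 1 - hatMatrix X := by
      rw [Matrix.sub_mul, Matrix.one_mul, Matrix.mul_sub, Matrix.mul_one, hatMatrix_mul_self,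
        sub_self, sub_zero]
    have := norm_mul_le_of_projection Y h3 h4
    rwa [Matrix.mul_sub, Matrix.mul_one, ← hBX] at this
  rw [sigmaHat, e1, add_mul]
  refine (norm_add_le _ _).trans (add_le_add ?_ ?_)
  · refine (norm_sampleCov_le hn _).trans ?_
    gcongr
  · refine (norm_diagonal_diag_le _).trans ?_
    rw [norm_smul, Real.norm_of_nonneg (by positivity)]
    gcongr
    refine (Matrix.frobenius_norm_mul _ _).trans ?_
    rw [Matrix.frobenius_norm_transpose, ← sq]
    gcongr

end FrobeniusNorm

end FactorCov

namespace FactorCov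

section Perturbation

attribute [local instance] Matrix.frobeniusNormedAddCommGroup Matrix.frobeniusNormedSpace

/-! ### Perturbation bounds for the estimators -/

/-- Expand around the population moments `Γ` and `m`. The term `4 * L / n` pays for the
normalisation by `n - 1` instead of `n`. -/
theorem norm_sampleCov_sub_le {d n : ℕ} (hn : 2 ≤ n) (Z : Matrix (Fin d) (Fin n) ℝ)
    (Γ : Matrix (Fin d) (Fin d) ℝ) (m : Matrix (Fin d) Unit ℝ) {a b L : ℝ}
    (ha : ‖(n : ℝ)⁻¹ • (Z * Z.transpose) - Γ‖ ≤ a) (hb : ‖sampleMean Z - m‖ ≤ b)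
    (hΓ : ‖Γ‖ ≤ L) (hm : ‖m‖ ^ 2 ≤ L) :
    ‖sampleCov Z - (Γ - m * m.transpose)‖ ≤ 2 * (a + 2 * √L * b + b ^ 2) + 4 * L / n := by
  have h2 : (2 : ℝ) ≤ n := by exact_mod_cast hn
  have h0 : (n : ℝ) ≠ 0 := by linarith
  have h1 : (0 : ℝ) < (n : ℝ) - 1 := by linarith
  have hr : (n : ℝ) / (n - 1) ≤ 2 := by rw [div_le_iff₀ h1]; linarith
  have hr0 : 0 ≤ (n : ℝ) / (n - 1) := by positivity
  have hr1 : ((n : ℝ) - 1)⁻¹ ≤ 2 / n := by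
    rw [inv_eq_one_div, div_le_div_iff₀ h1 (by linarith)]; linarith
  have ha0 := (norm_nonneg _).trans ha
  have hb0 := (norm_nonneg _).trans hb
  have hL0 := (norm_nonneg _).trans hΓ
  set G := (n : ℝ)⁻¹ • (Z * Z.transpose) with hG
  set D := sampleMean Z - m with hD
  have hsm : sampleMean Z = m + D := by rw [hD]; abel
  have key : sampleCov Z - (Γ - m * m.transpose)
      = ((n : ℝ) / (n - 1)) • ((G - Γ) - (D * m.transpose + m * D.transpose + D * D.transpose))
        + ((n : ℝ) - 1)⁻¹ • (Γ - m * m.transpose) := by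
    rw [sampleCov_eq hn, ← hG, hsm]
    have e : ((n : ℝ) - 1)⁻¹ = (n : ℝ) / (n - 1) - 1 := by field_simp; ring
    rw [e, sub_smul, one_smul, Matrix.transpose_add, Matrix.add_mul, Matrix.mul_add,
      Matrix.mul_add]
    simp only [smul_sub, smul_add]
    abel
  have hm1 : ‖m‖ ≤ √L := Real.le_sqrt_of_sq_le hm
  have n1 : ‖D * m.transpose‖ ≤ b * √L := by
    refine (Matrix.frobenius_norm_mul _ _).trans ?_
    rw [Matrix.frobenius_norm_transpose]
    gcongr
  have n2 : ‖m * D.transpose‖ ≤ √L * b := by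
    refine (Matrix.frobenius_norm_mul _ _).trans ?_
    rw [Matrix.frobenius_norm_transpose]
    gcongr
  have n3 : ‖D * D.transpose‖ ≤ b ^ 2 := by
    refine (Matrix.frobenius_norm_mul _ _).trans ?_
    rw [Matrix.frobenius_norm_transpose, ← sq]
    gcongr
  have n4 : ‖m * m.transpose‖ ≤ L := by
    refine (Matrix.frobenius_norm_mul _ _).trans ?_
    rw [Matrix.frobenius_norm_transpose, ← sq]
    exact hm
  have n5 : ‖(G - Γ) - (D * m.transpose + m * D.transpose + D * D.transpose)‖
      ≤ a + 2 * √L * b + b ^ 2 := by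
    refine (norm_sub_le _ _).trans ?_
    have := norm_add₃_le (a := D * m.transpose) (b := m * D.transpose) (c := D * D.transpose)
    linarith
  have n6 : ‖Γ - m * m.transpose‖ ≤ 2 * L := by
    refine (norm_sub_le _ _).trans ?_
    linarith
  rw [key]
  refine (norm_add_le _ _).trans (add_le_add ?_ ?_)
  · rw [norm_smul, Real.norm_of_nonneg hr0]
    gcongr
  · rw [norm_smul, Real.norm_of_nonneg (by positivity)]
    calc ((n : ℝ) - 1)⁻¹ * ‖Γ - m * m.transpose‖ ≤ 2 / n * (2 * L) := by gcongr
      _ = 4 * L / n := by ring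

/-! ### Least-squares loadings and the expansion of the factor-model estimator -/

theorem norm_sq_mul_le_of_quadGE {p K : ℕ} {G : Matrix (Fin K) (Fin K) ℝ} {σ : ℝ}
    (hG : QuadGE G σ) (D : Matrix (Fin p) (Fin K) ℝ) :
    σ * ‖D‖ ^ 2 ≤ (D * G * D.transpose).trace := by
  rw [frobenius_norm_sq, Finset.mul_sum, Matrix.trace]
  refine Finset.sum_le_sum fun i _ => ?_
  have h := hG (D i)
  have e1 : D i ⬝ᵥ D i = ∑ j, D i j ^ 2 := by simp [dotProduct, sq]
  have e2 : D i ⬝ᵥ G.mulVec (D i) = (D * G * D.transpose).diag i := by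
    rw [Matrix.dotProduct_mulVec, Matrix.diag_apply, Matrix.mul_apply]
    exact Finset.sum_congr rfl fun j _ => by
      simp [Matrix.vecMul, Matrix.mul_apply, dotProduct]
  rw [← e1, ← e2]
  exact h

theorem abs_trace_mul_transpose_le {p K : ℕ} (A D : Matrix (Fin p) (Fin K) ℝ) :
    |(A * D.transpose).trace| ≤ ‖A‖ * ‖D‖ := by
  apply abs_le_of_sq_le_sq _ (by positivity)
  have h := Finset.sum_mul_sq_le_sq_mul_sq (Finset.univ : Finset (Fin p × Fin K))
    (fun q => A q.1 q.2) (fun q => D q.1 q.2)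
  simp only [Fintype.sum_prod_type] at h
  rw [mul_pow, frobenius_norm_sq, frobenius_norm_sq]
  simpa [Matrix.trace, Matrix.mul_apply] using h

/-- Solves for `D` without estimating an inverse: `σ‖D‖² ≤ tr(D G D') = tr(A D') ≤ ‖A‖‖D‖`. -/
theorem norm_le_of_mul_eq {p K : ℕ} {G : Matrix (Fin K) (Fin K) ℝ} {σ : ℝ} (hσ : 0 < σ)
    (hG : QuadGE G σ) {A D : Matrix (Fin p) (Fin K) ℝ} (h : D * G = A) : ‖D‖ ≤ ‖A‖ / σ := by
  have h1 := norm_sq_mul_le_of_quadGE hG D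
  rw [h] at h1
  have h2 := (le_abs_self _).trans (abs_trace_mul_transpose_le A D)
  rw [le_div_iff₀ hσ]
  rcases (norm_nonneg D).eq_or_lt with h0 | h0
  · rw [← h0, zero_mul]; positivity
  · nlinarith

/-- The uncentred second moment is `(n - 1)/n` times the sample covariance plus a positive
semidefinite rank-one term, and `(n - 1)/n ≥ 1/2`. -/
theorem quadGE_secondMoment {K n : ℕ} (hn : 2 ≤ n) (X : Matrix (Fin K) (Fin n) ℝ) {σ : ℝ}
    (hσ : 0 ≤ σ) (h : QuadGE (sampleCov X) σ) :
    QuadGE ((n : ℝ)⁻¹ • (X * X.transpose)) (σ / 2) := by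
  intro x
  have h2 : (2 : ℝ) ≤ n := by exact_mod_cast hn
  have hx : 0 ≤ x ⬝ᵥ x := Finset.sum_nonneg fun i _ => mul_self_nonneg _
  have e : (n : ℝ)⁻¹ • (X * X.transpose) = (((n : ℝ) - 1) / n) • sampleCov X
      + sampleMean X * (sampleMean X).transpose := by
    have h0 : (n : ℝ) ≠ 0 := by linarith
    have h1 : (n : ℝ) - 1 ≠ 0 := by linarith
    rw [sampleCov_eq hn, smul_smul, div_mul_div_cancel₀ h0, div_self h1, one_smul, sub_add_cancel]
  have hps : 0 ≤ x ⬝ᵥ (sampleMean X * (sampleMean X).transpose).mulVec x := by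
    simpa using (Matrix.posSemidef_self_mul_conjTranspose
      (sampleMean X)).dotProduct_mulVec_nonneg x
  have hr : 1 / 2 ≤ ((n : ℝ) - 1) / n := by
    rw [div_le_div_iff₀ (by norm_num) (by linarith)]; linarith
  rw [e, Matrix.add_mulVec, dotProduct_add, Matrix.smul_mulVec, dotProduct_smul, smul_eq_mul]
  have h3 : 1 / 2 * (x ⬝ᵥ (sampleCov X).mulVec x)
      ≤ ((n : ℝ) - 1) / n * (x ⬝ᵥ (sampleCov X).mulVec x) :=
    mul_le_mul_of_nonneg_right hr ((mul_nonneg hσ hx).trans (h x))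
  have := h x
  linarith

/-- The loading error `D = B̂ - B` solves the normal equations `D G = A`, where `G = n⁻¹ X X'` and
`A = n⁻¹ E X'`. Hence its norm is at most `α / (σ / 4)`: one halving of `σ` comes from replacing `Φ`
by the sample covariance, the other from passing to `G`. The rest is a multilinear expansion in `D`
and `S - Φ`. -/
theorem norm_sigmaHat_sub_le {p K n : ℕ} (hn : 2 ≤ n) (X : Matrix (Fin K) (Fin n) ℝ)
    (Y : Matrix (Fin p) (Fin n) ℝ) (B : Matrix (Fin p) (Fin K) ℝ)
    (Φ : Matrix (Fin K) (Fin K) ℝ) (S0 : Matrix (Fin p) (Fin p) ℝ) (hS0 : S0.IsDiag)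
    {σ α β γ : ℝ} (hσ : 0 < σ) (hΦ : QuadGE Φ σ)
    (hβ : ‖sampleCov X - Φ‖ ≤ β) (hβσ : β ≤ σ / 2)
    (hα : ‖(n : ℝ)⁻¹ • ((Y - B * X) * X.transpose)‖ ≤ α)
    (hγ : ‖(n : ℝ)⁻¹ • ((Y - B * X) * (Y - B * X).transpose) - S0‖ ≤ γ) :
    ‖sigmaHat X Y - (B * Φ * B.transpose + S0)‖ ≤ ‖B‖ ^ 2 * β
      + 2 * (α / (σ / 4)) * (‖Φ‖ + β) * ‖B‖ + (α / (σ / 4)) ^ 2 * (‖Φ‖ + β) + γ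
      + α / (σ / 4) * α := by
  have h2 : (2 : ℝ) ≤ n := by exact_mod_cast hn
  have h0 : (n : ℝ) ≠ 0 := by linarith
  set E := Y - B * X with hE
  set G := (n : ℝ)⁻¹ • (X * X.transpose) with hG
  set A := (n : ℝ)⁻¹ • (E * X.transpose) with hA
  set S := sampleCov X with hS
  have hSσ : QuadGE S (σ / 2) := by
    intro x
    have hx : 0 ≤ x ⬝ᵥ x := Finset.sum_nonneg fun i _ => mul_self_nonneg _
    have := hΦ.of_norm_sub_le hβ x
    nlinarith
  have hGσ : QuadGE G (σ / 4) := by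
    have := quadGE_secondMoment hn X (by positivity) hSσ
    rwa [div_div, show (2 : ℝ) * 2 = 4 by norm_num] at this
  have hGs : G.IsHermitian := by
    rw [Matrix.IsHermitian, Matrix.conjTranspose_eq_transpose_of_trivial, hG,
      Matrix.transpose_smul, Matrix.transpose_mul, Matrix.transpose_transpose]
  -- The lower bound on `G` already forces `X X'` to be invertible.
  have hu : IsUnit (X * X.transpose).det := by
    have h1 : X * X.transpose = (n : ℝ) • G := by rw [hG, smul_smul, mul_inv_cancel₀ h0, one_smul]
    rw [h1, Matrix.det_smul]
    have := (hGσ.posDef (by positivity) hGs).det_pos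
    exact (mul_pos (pow_pos (by linarith) _) this).ne'.isUnit
  set D := loadingsHat X Y - B with hD
  have hB : loadingsHat X Y = B + D := by rw [hD]; abel
  have hDX : D * (X * X.transpose) = E * X.transpose := by
    rw [hD, loadingsHat, Matrix.sub_mul, Matrix.mul_assoc (Y * X.transpose),
      Matrix.nonsing_inv_mul _ hu, Matrix.mul_one, hE, Matrix.sub_mul, Matrix.mul_assoc B]
  have hDG : D * G = A := by rw [hG, hA, Matrix.mul_smul, hDX]
  have hDn : ‖D‖ ≤ α / (σ / 4) :=
    (norm_le_of_mul_eq (by positivity) hGσ hDG).trans (by gcongr)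
  have hα0 := (norm_nonneg _).trans hα
  have hβ0 := (norm_nonneg _).trans hβ
  set δ := α / (σ / 4) with hδ
  have hδ0 : 0 ≤ δ := by positivity
  -- In `(E - D X)(E - D X)'` both cross products and the square equal `D X X' D'` by the normal
  -- equations, so a single copy is subtracted, and it is `D A'` after scaling.
  have hres : (n : ℝ)⁻¹ • (residuals X Y * (residuals X Y).transpose)
      = (n : ℝ)⁻¹ • (E * E.transpose) - D * A.transpose := by
    have hR : residuals X Y = E - D * X := by
      rw [residuals, hB, Matrix.add_mul, hE]; abel
    have hXE : X * E.transpose = (X * X.transpose) * D.transpose := by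
      have := congrArg Matrix.transpose hDX
      simpa [Matrix.transpose_mul] using this.symm
    have hDA : D * A.transpose = (n : ℝ)⁻¹ • (D * (X * X.transpose) * D.transpose) := by
      rw [hA, Matrix.transpose_smul, Matrix.transpose_mul, Matrix.transpose_transpose, hXE,
        Matrix.mul_smul, ← Matrix.mul_assoc]
    have e1 : E * (D * X).transpose = D * (X * X.transpose) * D.transpose := by
      rw [Matrix.transpose_mul, ← Matrix.mul_assoc, hDX]
    have e2 : D * X * E.transpose = D * (X * X.transpose) * D.transpose := by
      rw [Matrix.mul_assoc, hXE, ← Matrix.mul_assoc]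
    have e3 : D * X * (D * X).transpose = D * (X * X.transpose) * D.transpose := by
      rw [Matrix.transpose_mul]; simp only [Matrix.mul_assoc]
    rw [hR, hDA, Matrix.transpose_sub, Matrix.sub_mul, Matrix.mul_sub, Matrix.mul_sub, e1, e2, e3,
      sub_self, sub_zero, smul_sub]
  -- As `S0` is diagonal, the difference is the diagonal part of a full matrix, and taking diagonals
  -- does not increase the norm.
  have hdiag : errorCovHat X Y - S0
      = Matrix.diagonal fun i =>
        ((n : ℝ)⁻¹ • (E * E.transpose) - S0 - D * A.transpose) i i := by
    have : S0 = Matrix.diagonal fun i => S0 i i := by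
      rw [← hS0.diagonal_diag]; simp
    rw [errorCovHat, hres]
    conv_lhs => rw [this]
    rw [Matrix.diagonal_sub]
    congr 1
    ext i
    simp only [Matrix.sub_apply]
    ring
  have hSn : ‖S‖ ≤ ‖Φ‖ + β := by
    have := norm_add_le (S - Φ) Φ
    rw [sub_add_cancel] at this
    linarith
  set κ := ‖Φ‖ + β with hκ
  have hκ0 : 0 ≤ κ := by positivity
  have key : sigmaHat X Y - (B * Φ * B.transpose + S0)
      = B * (S - Φ) * B.transpose + (D * S * B.transpose + B * S * D.transpose)
        + D * S * D.transpose + (errorCovHat X Y - S0) := by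
    rw [sigmaHat, hB, Matrix.transpose_add]
    simp only [Matrix.add_mul, Matrix.mul_add, Matrix.mul_sub, Matrix.sub_mul]
    abel
  have mul3 : ∀ (U V : Matrix (Fin p) (Fin K) ℝ) (T : Matrix (Fin K) (Fin K) ℝ) (u v t : ℝ),
      ‖U‖ ≤ u → ‖V‖ ≤ v → ‖T‖ ≤ t → ‖U * T * V.transpose‖ ≤ u * t * v := by
    intro U V T u v t hu hv ht
    have := (norm_nonneg _).trans hu
    have := (norm_nonneg _).trans ht
    refine (Matrix.frobenius_norm_mul _ _).trans ?_
    rw [Matrix.frobenius_norm_transpose]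
    refine mul_le_mul ((Matrix.frobenius_norm_mul _ _).trans ?_) hv (norm_nonneg _) (by positivity)
    gcongr
  have n1 := mul3 B B (S - Φ) _ _ _ le_rfl le_rfl hβ
  have n2 := mul3 D B S _ _ _ hDn le_rfl hSn
  have n3 := mul3 B D S _ _ _ le_rfl hDn hSn
  have n4 := mul3 D D S _ _ _ hDn hDn hSn
  have n5 : ‖errorCovHat X Y - S0‖ ≤ γ + δ * α := by
    rw [hdiag]
    refine (norm_diagonal_diag_le _).trans ((norm_sub_le _ _).trans (add_le_add hγ ?_))
    refine (Matrix.frobenius_norm_mul _ _).trans ?_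
    rw [Matrix.frobenius_norm_transpose]
    gcongr
  rw [key]
  refine (norm_add_le _ _).trans ?_
  have a1 := norm_add_le (B * (S - Φ) * B.transpose + (D * S * B.transpose + B * S * D.transpose))
    (D * S * D.transpose)
  have a2 := norm_add_le (B * (S - Φ) * B.transpose) (D * S * B.transpose + B * S * D.transpose)
  have a3 := norm_add_le (D * S * B.transpose) (B * S * D.transpose)
  nlinarith

end Perturbation

end FactorCov

namespace FactorCov

section Concentration

attribute [local instance] Matrix.frobeniusNormedAddCommGroup Matrix.frobeniusNormedSpace

/-! ### Concentration of sample averages -/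

variable {Ω 𝒳 : Type*} [MeasurableSpace Ω] [MeasurableSpace 𝒳] {P : Measure Ω}
  [IsProbabilityMeasure P] {n : ℕ} {ζ : Fin n → Ω → 𝒳} {ζ₀ : Ω → 𝒳}

/-- The mean squared deviation is the variance of the average, which independence makes `n⁻¹` times
a single variance. -/
theorem integral_average_sub_sq_le (hn : 1 ≤ n) (hind : iIndepFun ζ P)
    (hid : ∀ i, IdentDistrib (ζ i) ζ₀ P P) {g : 𝒳 → ℝ} (hg : Measurable g)
    (hg2 : MemLp (fun ω => g (ζ₀ ω)) 2 P) :
    Integrable (fun ω => ((n : ℝ)⁻¹ * ∑ i, g (ζ i ω) - ∫ ω, g (ζ₀ ω) ∂P) ^ 2) P ∧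
      ∫ ω, ((n : ℝ)⁻¹ * ∑ i, g (ζ i ω) - ∫ ω, g (ζ₀ ω) ∂P) ^ 2 ∂P
        ≤ (n : ℝ)⁻¹ * ∫ ω, g (ζ₀ ω) ^ 2 ∂P := by
  have h0 : (n : ℝ) ≠ 0 := by positivity
  have hidg : ∀ i, IdentDistrib (fun ω => g (ζ i ω)) (fun ω => g (ζ₀ ω)) P P :=
    fun i => (hid i).comp hg
  have hLp : ∀ i, MemLp (fun ω => g (ζ i ω)) 2 P := fun i => (hidg i).memLp_iff.2 hg2
  set A : Ω → ℝ := fun ω => (n : ℝ)⁻¹ * ∑ i, g (ζ i ω) with hA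
  have hsum : MemLp (fun ω => ∑ i, g (ζ i ω)) 2 P := memLp_finsetSum _ fun i _ => hLp i
  have hAL : MemLp A 2 P := hsum.const_mul _
  have hmean : ∫ ω, A ω ∂P = ∫ ω, g (ζ₀ ω) ∂P := by
    rw [hA, integral_const_mul, integral_finsetSum _ fun i _ => (hLp i).integrable (by norm_num)]
    simp only [(hidg _).integral_eq, Finset.sum_const, Finset.card_univ, Fintype.card_fin,
      nsmul_eq_mul]
    field_simp
  have hvar : Var[A; P] = (n : ℝ)⁻¹ * Var[fun ω => g (ζ₀ ω); P] := by
    have hs : (fun ω => ∑ i, g (ζ i ω)) = ∑ i, fun ω => g (ζ i ω) := by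
      ext ω; simp
    rw [hA, variance_const_mul, hs, IndepFun.variance_sum (fun i _ => hLp i)
      (fun i _ j _ hij => (hind.indepFun hij).comp hg hg)]
    simp only [(hidg _).variance_eq, Finset.sum_const, Finset.card_univ, Fintype.card_fin,
      nsmul_eq_mul]
    field_simp
  have hi : Integrable (fun ω => (A ω - ∫ ω, g (ζ₀ ω) ∂P) ^ 2) P :=
    (hAL.sub (memLp_const _)).integrable_sq
  refine ⟨hi, ?_⟩
  have := variance_eq_integral (X := A) hAL.aemeasurable
  rw [hmean] at this
  change ∫ ω, (A ω - ∫ ω, g (ζ₀ ω) ∂P) ^ 2 ∂P ≤ _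
  rw [← this, hvar]
  gcongr
  exact variance_le_expectation_sq hg2.aestronglyMeasurable

/-- Chebyshev's inequality for the Frobenius norm of a centred average of matrices. -/
theorem measureReal_norm_average_sub_gt_le {l m : Type*} [Fintype l] [Fintype m]
    (hn : 1 ≤ n) (hind : iIndepFun ζ P)
    (hid : ∀ i, IdentDistrib (ζ i) ζ₀ P P) {W : 𝒳 → Matrix l m ℝ}
    (hW : ∀ a b, Measurable fun x => W x a b) (hW2 : ∀ a b, MemLp (fun ω => W (ζ₀ ω) a b) 2 P)
    {L s : ℝ} (hL : 0 < L) (hs : 0 < s)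
    (hWL : ∑ a, ∑ b, ∫ ω, W (ζ₀ ω) a b ^ 2 ∂P ≤ L ^ 2) :
    P.real {ω | s * L / √n < ‖(n : ℝ)⁻¹ • ∑ i, W (ζ i ω)
      - Matrix.of fun a b => ∫ ω, W (ζ₀ ω) a b ∂P‖} ≤ 1 / s ^ 2 := by
  have hn0 : (0 : ℝ) < n := by positivity
  have hnorm : ∀ ω, ‖(n : ℝ)⁻¹ • ∑ i, W (ζ i ω) - Matrix.of fun a b => ∫ ω, W (ζ₀ ω) a b ∂P‖ ^ 2
      = ∑ a, ∑ b, ((n : ℝ)⁻¹ * ∑ i, W (ζ i ω) a b - ∫ ω, W (ζ₀ ω) a b ∂P) ^ 2 := by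
    intro ω
    rw [frobenius_norm_sq]
    simp [Matrix.sum_apply]
  have hab := fun a b => integral_average_sub_sq_le hn hind hid (hW a b) (hW2 a b)
  have hint : Integrable (fun ω =>
      ∑ a, ∑ b, ((n : ℝ)⁻¹ * ∑ i, W (ζ i ω) a b - ∫ ω, W (ζ₀ ω) a b ∂P) ^ 2) P :=
    integrable_finsetSum _ fun a _ => integrable_finsetSum _ fun b _ => (hab a b).1
  have hle : ∫ ω, ∑ a, ∑ b, ((n : ℝ)⁻¹ * ∑ i, W (ζ i ω) a b - ∫ ω, W (ζ₀ ω) a b ∂P) ^ 2 ∂P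
      ≤ (n : ℝ)⁻¹ * L ^ 2 := by
    rw [integral_finsetSum _ fun a _ => integrable_finsetSum _ fun b _ => (hab a b).1]
    simp only [integral_finsetSum _ fun b _ => (hab _ b).1]
    calc _ ≤ ∑ a, ∑ b, (n : ℝ)⁻¹ * ∫ ω, W (ζ₀ ω) a b ^ 2 ∂P :=
          Finset.sum_le_sum fun a _ => Finset.sum_le_sum fun b _ => (hab a b).2
      _ = (n : ℝ)⁻¹ * ∑ a, ∑ b, ∫ ω, W (ζ₀ ω) a b ^ 2 ∂P := by
          simp only [Finset.mul_sum]
      _ ≤ _ := by gcongr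
  have hM := mul_meas_ge_le_integral_of_nonneg (μ := P)
    (Eventually.of_forall fun ω => Finset.sum_nonneg fun a _ => Finset.sum_nonneg fun b _ =>
      sq_nonneg _) hint ((s * L / √n) ^ 2)
  have hsub : P.real {ω | s * L / √n < ‖(n : ℝ)⁻¹ • ∑ i, W (ζ i ω)
      - Matrix.of fun a b => ∫ ω, W (ζ₀ ω) a b ∂P‖}
      ≤ P.real {ω | (s * L / √n) ^ 2 ≤
        ∑ a, ∑ b, ((n : ℝ)⁻¹ * ∑ i, W (ζ i ω) a b - ∫ ω, W (ζ₀ ω) a b ∂P) ^ 2} := by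
    refine measureReal_mono fun ω hω => ?_
    simp only [Set.mem_ofPred_eq] at hω ⊢
    rw [← hnorm]
    gcongr
  refine hsub.trans ?_
  have h3 := hM.trans hle
  rw [div_pow, Real.sq_sqrt hn0.le] at h3
  rw [div_pow, Real.sq_sqrt hn0.le, le_div_iff₀ (by positivity)]
  have h4 : (s * L) ^ 2 / n * P.real {ω | (s * L) ^ 2 / n ≤
        ∑ a, ∑ b, ((n : ℝ)⁻¹ * ∑ i, W (ζ i ω) a b - ∫ ω, W (ζ₀ ω) a b ∂P) ^ 2}
      = (n : ℝ)⁻¹ * L ^ 2 * (P.real {ω | (s * L) ^ 2 / n ≤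
        ∑ a, ∑ b, ((n : ℝ)⁻¹ * ∑ i, W (ζ i ω) a b - ∫ ω, W (ζ₀ ω) a b ∂P) ^ 2} * s ^ 2) := by
    field_simp
  rw [h4] at h3
  have hpos : 0 < (n : ℝ)⁻¹ * L ^ 2 := by positivity
  exact le_of_mul_le_mul_left (by linarith) hpos

/-! ### Population moments and concentration of the sample covariance -/

theorem integral_sq_le_integral_sq {u : Ω → ℝ} (hu : MemLp u 2 P) :
    (∫ ω, u ω ∂P) ^ 2 ≤ ∫ ω, u ω ^ 2 ∂P := by
  have h := variance_nonneg u P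
  rw [variance_eq_sub hu] at h
  simp only [Pi.pow_apply] at h
  linarith

/-- The matrix `E(z z')` of second moments. -/
noncomputable def secondMoment {d : ℕ} (P : Measure Ω) (z : Ω → Fin d → ℝ) :
    Matrix (Fin d) (Fin d) ℝ :=
  Matrix.of fun a b => ∫ ω, z ω a * z ω b ∂P

/-- The mean `E(z)`, as a column. -/
noncomputable def meanCol {d : ℕ} (P : Measure Ω) (z : Ω → Fin d → ℝ) : Matrix (Fin d) Unit ℝ :=
  Matrix.of fun a _ => ∫ ω, z ω a ∂P

theorem covMat_eq_secondMoment_sub {d : ℕ} {z : Ω → Fin d → ℝ}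
    (hz : ∀ a, MemLp (fun ω => z ω a) 2 P) :
    covMat P z = secondMoment P z - meanCol P z * (meanCol P z).transpose := by
  ext a b
  simp [covMat, secondMoment, meanCol, Matrix.mul_apply, covariance_eq_sub (hz a) (hz b)]

theorem norm_secondMoment_le {d : ℕ} {z : Ω → Fin d → ℝ}
    (hz : ∀ a b, MemLp (fun ω => z ω a * z ω b) 2 P) {L : ℝ} (hL : 0 ≤ L)
    (h : ∑ a, ∑ b, ∫ ω, (z ω a * z ω b) ^ 2 ∂P ≤ L ^ 2) : ‖secondMoment P z‖ ≤ L := by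
  apply le_of_sq_le_sq _ hL
  rw [frobenius_norm_sq]
  refine le_trans ?_ h
  exact Finset.sum_le_sum fun a _ => Finset.sum_le_sum fun b _ =>
    integral_sq_le_integral_sq (hz a b)

theorem norm_meanCol_sq_le {d : ℕ} {z : Ω → Fin d → ℝ}
    (hz : ∀ a, MemLp (fun ω => z ω a) 2 P) {L : ℝ}
    (h : ∑ a, ∫ ω, z ω a ^ 2 ∂P ≤ L) : ‖meanCol P z‖ ^ 2 ≤ L := by
  rw [frobenius_norm_sq]
  refine le_trans ?_ h
  refine Finset.sum_le_sum fun a _ => ?_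
  simpa [meanCol] using integral_sq_le_integral_sq (hz a)

theorem norm_covMat_le {d : ℕ} {z : Ω → Fin d → ℝ} (hz1 : ∀ a, MemLp (fun ω => z ω a) 2 P)
    (hz2 : ∀ a b, MemLp (fun ω => z ω a * z ω b) 2 P) {L : ℝ} (hL : 0 ≤ L)
    (hL1 : ∑ a, ∫ ω, z ω a ^ 2 ∂P ≤ L)
    (hL2 : ∑ a, ∑ b, ∫ ω, (z ω a * z ω b) ^ 2 ∂P ≤ L ^ 2) : ‖covMat P z‖ ≤ 2 * L := by
  rw [covMat_eq_secondMoment_sub hz1]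
  have h1 := norm_secondMoment_le hz2 hL hL2
  have h2 := norm_meanCol_sq_le hz1 hL1
  have h3 := Matrix.frobenius_norm_mul (meanCol P z) (meanCol P z).transpose
  rw [Matrix.frobenius_norm_transpose, ← sq] at h3
  linarith [norm_sub_le (secondMoment P z) (meanCol P z * (meanCol P z).transpose)]

/-- Concentration of the sample covariance matrix at rate `L / √n`, where `L ^ 2` bounds the fourth
moment `E‖z‖⁴` and `L` bounds the second moment `E‖z‖²`. -/
theorem measureReal_norm_sampleCov_sub_gt_le {d : ℕ} (hn : 2 ≤ n) (hind : iIndepFun ζ P)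
    (hid : ∀ i, IdentDistrib (ζ i) ζ₀ P P) {z : 𝒳 → Fin d → ℝ} (hz : Measurable z)
    (hz1 : ∀ a, MemLp (fun ω => z (ζ₀ ω) a) 2 P)
    (hz2 : ∀ a b, MemLp (fun ω => z (ζ₀ ω) a * z (ζ₀ ω) b) 2 P)
    {L s : ℝ} (hL : 0 < L) (hs : 1 ≤ s) (hL1 : ∑ a, ∫ ω, z (ζ₀ ω) a ^ 2 ∂P ≤ L)
    (hL2 : ∑ a, ∑ b, ∫ ω, (z (ζ₀ ω) a * z (ζ₀ ω) b) ^ 2 ∂P ≤ L ^ 2) :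
    P.real {ω | 12 * s ^ 2 * L / √n < ‖sampleCov (dataMatrix (fun i ω => z (ζ i ω)) ω)
      - covMat P (fun ω => z (ζ₀ ω))‖} ≤ 2 / s ^ 2 := by
  have hn1 : 1 ≤ n := by omega
  have hn0 : (0 : ℝ) < n := by positivity
  have hza : ∀ a, Measurable fun x => z x a := fun a => (measurable_pi_apply a).comp hz
  set Γ := secondMoment P (fun ω => z (ζ₀ ω)) with hΓ
  set m := meanCol P (fun ω => z (ζ₀ ω)) with hm
  have hcov : covMat P (fun ω => z (ζ₀ ω)) = Γ - m * m.transpose :=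
    covMat_eq_secondMoment_sub hz1
  have hΓn : ‖Γ‖ ≤ L := norm_secondMoment_le hz2 hL.le hL2
  have hmn : ‖m‖ ^ 2 ≤ L := norm_meanCol_sq_le hz1 hL1
  -- Chebyshev is used twice: for `zz'` at scale `L`, then for `z` at scale `√L`.
  have e1 := measureReal_norm_average_sub_gt_le hn1 hind hid
    (W := fun x => Matrix.of fun a b => z x a * z x b) (fun a b => (hza a).mul (hza b)) hz2 hL
    (zero_lt_one.trans_le hs) hL2
  have e2 := measureReal_norm_average_sub_gt_le hn1 hind hid
    (W := fun x => Matrix.of fun a (_ : Unit) => z x a) (fun a _ => hza a) (fun a _ => hz1 a)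
    (Real.sqrt_pos.2 hL) (zero_lt_one.trans_le hs) (by simpa [Real.sq_sqrt hL.le] using hL1)
  have hunion := (measureReal_union_le (μ := P) _ _).trans (add_le_add e1 e2)
  refine (measureReal_mono fun ω hω => ?_).trans (hunion.trans_eq (by ring))
  by_contra hcon
  simp only [Set.mem_union, Set.mem_ofPred_eq, not_or, not_lt] at hcon hω
  obtain ⟨c1, c2⟩ := hcon
  set Z := dataMatrix (fun i ω => z (ζ i ω)) ω with hZ
  have i1 : (∑ i, Matrix.of fun a b => z (ζ i ω) a * z (ζ i ω) b) = Z * Z.transpose := by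
    ext a b
    simp [Matrix.sum_apply, Matrix.mul_apply, hZ, dataMatrix]
  have i2 : (n : ℝ)⁻¹ • (∑ i, Matrix.of fun a (_ : Unit) => z (ζ i ω) a) = sampleMean Z := by
    ext a b
    simp [sampleMean, Matrix.sum_apply, Matrix.mul_apply, hZ, dataMatrix]
  rw [i1] at c1
  rw [i2] at c2
  have h := norm_sampleCov_sub_le hn Z Γ m c1 c2 hΓn hmn
  rw [← hcov] at h
  refine absurd (h.trans ?_) (not_le.2 hω)
  have hsq : √L ^ 2 = L := Real.sq_sqrt hL.le
  have hsn : √(n : ℝ) ^ 2 = n := Real.sq_sqrt hn0.le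
  have hn1' : 1 ≤ √(n : ℝ) := Real.one_le_sqrt.2 (by exact_mod_cast hn1)
  have hs2 : s ≤ s ^ 2 := by nlinarith
  have hs1 : 1 ≤ s ^ 2 := by nlinarith
  have hLn : L / n ≤ L / √n := by
    gcongr
    nlinarith
  have hq : 0 ≤ L / √n := by positivity
  have t1 : s * L / √n ≤ s ^ 2 * (L / √n) := by
    rw [mul_div_assoc]; gcongr
  have t2 : √L * (s * √L / √n) ≤ s ^ 2 * (L / √n) := by
    calc √L * (s * √L / √n) = s * (√L ^ 2 / √n) := by ring
      _ ≤ _ := by rw [hsq]; gcongr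
  have t3 : (s * √L / √n) ^ 2 ≤ s ^ 2 * (L / √n) := by
    calc (s * √L / √n) ^ 2 = s ^ 2 * (√L ^ 2 / √n ^ 2) := by ring
      _ ≤ _ := by rw [hsq, hsn]; gcongr
  have t4 : L / n ≤ s ^ 2 * (L / √n) := hLn.trans (by nlinarith)
  -- The constant is `12 = 2 (1 + 2 + 1) + 4`; each term is at most `s ^ 2 * (L / √n)` because `s ≥
  -- 1` and `n ≥ 1`.
  calc _ = 2 * (s * L / √n + 2 * (√L * (s * √L / √n)) + (s * √L / √n) ^ 2) + 4 * (L / n) := by ring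
    _ ≤ 12 * (s ^ 2 * (L / √n)) := by linarith
    _ = _ := by ring

end Concentration

end FactorCov

namespace FactorCov

section Model

attribute [local instance] Matrix.frobeniusNormedAddCommGroup Matrix.frobeniusNormedSpace

/-! ### Moments of the factor model -/

/-- The assumptions on the model at one sample size, with explicit constants. -/
structure ModelBounds {Ω : Type*} [MeasurableSpace Ω] (P : Measure Ω) (n p K : ℕ)
    (B : Matrix (Fin p) (Fin K) ℝ) (S0 : Matrix (Fin p) (Fin p) ℝ)
    (f : Ω → Fin K → ℝ) (ε : Ω → Fin p → ℝ)
    (F : Fin n → Ω → Fin K → ℝ) (Y : Fin n → Ω → Fin p → ℝ) (C σ₁ σ₂ : ℝ) : Prop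
    extends ConditionA P n p K B S0 f ε F Y where
  one_le_K : 1 ≤ K
  one_le_C : 1 ≤ C
  σ₁_pos : 0 < σ₁
  σ₂_pos : 0 < σ₂
  σ₁_le_one : σ₁ ≤ 1
  integral_returns_le : ∫ ω, ∑ i, returns B f ε ω i ^ 2 ∂P ≤ C * p
  integrable_factors : ∀ i, Integrable (fun ω => f ω i ^ 4) P
  integral_factors_le : ∀ i, ∫ ω, f ω i ^ 4 ∂P ≤ C
  integrable_errors : ∀ i, Integrable (fun ω => ε ω i ^ 4) P
  integral_errors_le : ∀ i, ∫ ω, ε ω i ^ 4 ∂P ≤ C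
  factors_cov : EigenvaluesGE (covMat P f) σ₁
  errors_cov : EigenvaluesGE S0 σ₂

theorem memLp_mul_of_integrable_pow_four {Ω : Type*} [MeasurableSpace Ω] {P : Measure Ω}
    {u v : Ω → ℝ} {C : ℝ} (hu : Measurable u) (hv : Measurable v)
    (hu4 : Integrable (fun ω => u ω ^ 4) P) (hv4 : Integrable (fun ω => v ω ^ 4) P)
    (huC : ∫ ω, u ω ^ 4 ∂P ≤ C) (hvC : ∫ ω, v ω ^ 4 ∂P ≤ C) :
    MemLp (fun ω => u ω * v ω) 2 P ∧ ∫ ω, (u ω * v ω) ^ 2 ∂P ≤ C := by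
  have hm : Measurable fun ω => u ω * v ω := hu.mul hv
  have hle : ∀ ω, (u ω * v ω) ^ 2 ≤ (u ω ^ 4 + v ω ^ 4) / 2 := fun ω => by
    nlinarith [sq_nonneg (u ω ^ 2 - v ω ^ 2)]
  have hint : Integrable (fun ω => (u ω ^ 4 + v ω ^ 4) / 2) P := (hu4.add hv4).div_const 2
  have hi : Integrable (fun ω => (u ω * v ω) ^ 2) P :=
    hint.mono' (hm.pow_const 2).aestronglyMeasurable (Eventually.of_forall fun ω => by
      rw [Real.norm_of_nonneg (sq_nonneg _)]; exact hle ω)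
  refine ⟨(memLp_two_iff_integrable_sq hm.aestronglyMeasurable).2 hi, ?_⟩
  refine (integral_mono hi hint hle).trans ?_
  rw [integral_div, integral_add hu4 hv4]
  linarith

/-- The product bound with second factor 1, whose fourth moment is covered by `1 ≤ C`. -/
theorem memLp_of_integrable_pow_four {Ω : Type*} [MeasurableSpace Ω] {P : Measure Ω}
    [IsProbabilityMeasure P] {u : Ω → ℝ} {C : ℝ} (hC : 1 ≤ C) (hu : Measurable u)
    (hu4 : Integrable (fun ω => u ω ^ 4) P) (huC : ∫ ω, u ω ^ 4 ∂P ≤ C) :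
    MemLp u 2 P ∧ ∫ ω, u ω ^ 2 ∂P ≤ C := by
  simpa using memLp_mul_of_integrable_pow_four hu (measurable_const (a := (1 : ℝ))) hu4
    (by simp) huC (by simpa using hC)

theorem returns_apply {Ω : Type*} {p K : ℕ} (B : Matrix (Fin p) (Fin K) ℝ) (f : Ω → Fin K → ℝ)
    (ε : Ω → Fin p → ℝ) (ω : Ω) (i : Fin p) :
    returns B f ε ω i = ∑ k, B i k * f ω k + ε ω i := rfl

theorem covMat_isHermitian {Ω : Type*} [MeasurableSpace Ω] {d : ℕ} (P : Measure Ω)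
    (Z : Ω → Fin d → ℝ) : (covMat P Z).IsHermitian := by
  ext a b
  simp [covMat, covariance_comm]

namespace ModelBounds

variable {Ω : Type*} [MeasurableSpace Ω] {P : Measure Ω} {n p K : ℕ}
  {B : Matrix (Fin p) (Fin K) ℝ} {S0 : Matrix (Fin p) (Fin p) ℝ}
  {f : Ω → Fin K → ℝ} {ε : Ω → Fin p → ℝ}
  {F : Fin n → Ω → Fin K → ℝ} {Y : Fin n → Ω → Fin p → ℝ} {C σ₁ σ₂ : ℝ}

theorem measurable_factor (h : ModelBounds P n p K B S0 f ε F Y C σ₁ σ₂) (k : Fin K) :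
    Measurable fun ω => f ω k :=
  (measurable_pi_apply k).comp h.measurable_factors

theorem measurable_error (h : ModelBounds P n p K B S0 f ε F Y C σ₁ σ₂) (i : Fin p) :
    Measurable fun ω => ε ω i :=
  (measurable_pi_apply i).comp h.measurable_errors

theorem one_le_p (h : ModelBounds P n p K B S0 f ε F Y C σ₁ σ₂) : 1 ≤ p :=
  h.one_le_K.trans h.K_le_p

theorem quadGE_factors (h : ModelBounds P n p K B S0 f ε F Y C σ₁ σ₂) :
    QuadGE (covMat P f) σ₁ :=
  h.factors_cov.quadGE (covMat_isHermitian P f)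

theorem factor_mul_factor (h : ModelBounds P n p K B S0 f ε F Y C σ₁ σ₂) (k l : Fin K) :
    MemLp (fun ω => f ω k * f ω l) 2 P ∧ ∫ ω, (f ω k * f ω l) ^ 2 ∂P ≤ C :=
  memLp_mul_of_integrable_pow_four (h.measurable_factor k) (h.measurable_factor l)
    (h.integrable_factors k) (h.integrable_factors l) (h.integral_factors_le k)
    (h.integral_factors_le l)

theorem error_mul_factor (h : ModelBounds P n p K B S0 f ε F Y C σ₁ σ₂) (i : Fin p) (k : Fin K) :
    MemLp (fun ω => ε ω i * f ω k) 2 P ∧ ∫ ω, (ε ω i * f ω k) ^ 2 ∂P ≤ C :=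
  memLp_mul_of_integrable_pow_four (h.measurable_error i) (h.measurable_factor k)
    (h.integrable_errors i) (h.integrable_factors k) (h.integral_errors_le i)
    (h.integral_factors_le k)

theorem error_mul_error (h : ModelBounds P n p K B S0 f ε F Y C σ₁ σ₂) (i j : Fin p) :
    MemLp (fun ω => ε ω i * ε ω j) 2 P ∧ ∫ ω, (ε ω i * ε ω j) ^ 2 ∂P ≤ C :=
  memLp_mul_of_integrable_pow_four (h.measurable_error i) (h.measurable_error j)
    (h.integrable_errors i) (h.integrable_errors j) (h.integral_errors_le i)
    (h.integral_errors_le j)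

theorem sum_factor_mul_factor_sq_le (h : ModelBounds P n p K B S0 f ε F Y C σ₁ σ₂) :
    ∑ k, ∑ l, ∫ ω, (f ω k * f ω l) ^ 2 ∂P ≤ C * K ^ 2 := by
  refine (Finset.sum_le_sum fun k _ => Finset.sum_le_sum fun l _ =>
    (h.factor_mul_factor k l).2).trans_eq ?_
  simp; ring

theorem sum_error_mul_factor_sq_le (h : ModelBounds P n p K B S0 f ε F Y C σ₁ σ₂) :
    ∑ i, ∑ l, ∫ ω, (ε ω i * f ω l) ^ 2 ∂P ≤ C * (p * K) := by
  refine (Finset.sum_le_sum fun k _ => Finset.sum_le_sum fun l _ =>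
    (h.error_mul_factor k l).2).trans_eq ?_
  simp; ring

theorem sum_error_mul_error_sq_le (h : ModelBounds P n p K B S0 f ε F Y C σ₁ σ₂) :
    ∑ i, ∑ j, ∫ ω, (ε ω i * ε ω j) ^ 2 ∂P ≤ C * p ^ 2 := by
  refine (Finset.sum_le_sum fun k _ => Finset.sum_le_sum fun l _ =>
    (h.error_mul_error k l).2).trans_eq ?_
  simp; ring

variable [IsProbabilityMeasure P]

theorem factor_moment (h : ModelBounds P n p K B S0 f ε F Y C σ₁ σ₂) (k : Fin K) :
    MemLp (fun ω => f ω k) 2 P ∧ ∫ ω, f ω k ^ 2 ∂P ≤ C :=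
  memLp_of_integrable_pow_four h.one_le_C (h.measurable_factor k) (h.integrable_factors k)
    (h.integral_factors_le k)

theorem integral_error (h : ModelBounds P n p K B S0 f ε F Y C σ₁ σ₂) (i : Fin p) :
    ∫ ω, ε ω i ∂P = 0 := by
  rw [← integral_condExp h.measurable_factors.comap_le, integral_congr_ae (h.condMean i)]
  simp

theorem integral_error_mul_error (h : ModelBounds P n p K B S0 f ε F Y C σ₁ σ₂) (i j : Fin p) :
    ∫ ω, ε ω i * ε ω j ∂P = S0 i j := by
  rw [← integral_condExp h.measurable_factors.comap_le, integral_congr_ae (h.condCov i j)]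
  simp

/-- The factor is measurable with respect to the conditioning, so it can be pulled out of the
conditional expectation, leaving the conditional mean of the error. -/
theorem integral_error_mul_factor (h : ModelBounds P n p K B S0 f ε F Y C σ₁ σ₂) (i : Fin p)
    (k : Fin K) : ∫ ω, ε ω i * f ω k ∂P = 0 := by
  have hf : StronglyMeasurable[MeasurableSpace.comap f inferInstance] fun ω => f ω k :=
    ((measurable_pi_apply k).comp (comap_measurable f)).stronglyMeasurable
  have h1 := condExp_mul_of_stronglyMeasurable_right (f := fun ω => ε ω i) (μ := P) hf
    ((h.error_mul_factor i k).1.integrable (by norm_num))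
    ((h.memLp_errors i).integrable (by norm_num))
  have h2 : P[(fun ω => ε ω i) * (fun ω => f ω k) | MeasurableSpace.comap f inferInstance]
      =ᵐ[P] fun _ => (0 : ℝ) := by
    filter_upwards [h1, h.condMean i] with ω a b
    rw [a, Pi.mul_apply, b, zero_mul]
  have h3 := integral_condExp (μ := P) (f := (fun ω => ε ω i) * (fun ω => f ω k))
    h.measurable_factors.comap_le
  rw [integral_congr_ae h2] at h3
  simpa using h3.symm

theorem memLp_systematic (h : ModelBounds P n p K B S0 f ε F Y C σ₁ σ₂) (i : Fin p) :
    MemLp (fun ω => ∑ k, B i k * f ω k) 2 P :=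
  memLp_finsetSum _ fun k _ => (h.factor_moment k).1.const_mul _

theorem memLp_returns (h : ModelBounds P n p K B S0 f ε F Y C σ₁ σ₂) (i : Fin p) :
    MemLp (fun ω => returns B f ε ω i) 2 P :=
  (h.memLp_systematic i).add (h.memLp_errors i)

theorem covMat_returns (h : ModelBounds P n p K B S0 f ε F Y C σ₁ σ₂) :
    covMat P (returns B f ε) = B * covMat P f * B.transpose + S0 := by
  have hf := fun k => (h.factor_moment k).1
  have hBf := fun i k => (hf k).const_mul (B i k)
  have hfe : ∀ i k, covariance (fun ω => f ω k) (fun ω => ε ω i) P = 0 := by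
    intro i k
    rw [covariance_comm, covariance_eq_sub (h.memLp_errors i) (hf k), h.integral_error i]
    simpa using h.integral_error_mul_factor i k
  have hee : ∀ i j, covariance (fun ω => ε ω i) (fun ω => ε ω j) P = S0 i j := by
    intro i j
    rw [covariance_eq_sub (h.memLp_errors i) (h.memLp_errors j), h.integral_error i]
    simpa using h.integral_error_mul_error i j
  have hse : ∀ i j, covariance (fun ω => ∑ k, B i k * f ω k) (fun ω => ε ω j) P = 0 := by
    intro i j
    rw [covariance_fun_sum_left (hBf i) (h.memLp_errors j)]
    simp only [covariance_const_mul_left, hfe, mul_zero, Finset.sum_const_zero]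
  have hss : ∀ i j, covariance (fun ω => ∑ k, B i k * f ω k) (fun ω => ∑ k, B j k * f ω k) P
      = (B * covMat P f * B.transpose) i j := by
    intro i j
    rw [covariance_fun_sum_fun_sum (hBf i) (hBf j)]
    simp only [covariance_const_mul_left, covariance_const_mul_right, Matrix.mul_apply,
      Matrix.transpose_apply, covMat, Matrix.of_apply, Finset.sum_mul]
    rw [Finset.sum_comm]
    exact Finset.sum_congr rfl fun a _ => Finset.sum_congr rfl fun b _ => by ring
  ext i j
  have e : ∀ i, (fun ω => returns B f ε ω i)
      = (fun ω => ∑ k, B i k * f ω k) + fun ω => ε ω i := fun i => rfl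
  rw [covMat, Matrix.of_apply, e, e, covariance_add_left (h.memLp_systematic i) (h.memLp_errors i)
    ((h.memLp_systematic j).add (h.memLp_errors j)),
    covariance_add_right (h.memLp_systematic i) (h.memLp_systematic j) (h.memLp_errors j),
    covariance_add_right (h.memLp_errors i) (h.memLp_systematic j) (h.memLp_errors j),
    hse, covariance_comm (fun ω => ε ω i), hse, hss, hee, Matrix.add_apply]
  ring

theorem quadGE_returns (h : ModelBounds P n p K B S0 f ε F Y C σ₁ σ₂) :
    QuadGE (covMat P (returns B f ε)) σ₂ := by
  have hS : S0.IsHermitian := by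
    ext i j
    rw [Matrix.conjTranspose_apply, star_trivial, ← h.integral_error_mul_error,
      ← h.integral_error_mul_error]
    simp only [mul_comm]
  intro x
  have hps : (covMat P f).PosSemidef :=
    (h.quadGE_factors.posDef h.σ₁_pos (covMat_isHermitian P f)).posSemidef
  have h1 := (hps.mul_mul_conjTranspose_same B).dotProduct_mulVec_nonneg x
  simp only [star_trivial, Matrix.conjTranspose_eq_transpose_of_trivial] at h1
  have h2 := h.errors_cov.quadGE hS x
  rw [h.covMat_returns, Matrix.add_mulVec, dotProduct_add]
  linarith

theorem sum_integral_returns_sq_le (h : ModelBounds P n p K B S0 f ε F Y C σ₁ σ₂) :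
    ∑ i, ∫ ω, returns B f ε ω i ^ 2 ∂P ≤ C * p := by
  rw [← integral_finsetSum _ fun i _ => (h.memLp_returns i).integrable_sq]
  exact h.integral_returns_le

/-- No size condition on `B` is assumed: `σ₁‖B‖² ≤ tr(B cov(f) B') = tr(cov y) - tr(S0) ≤ E‖y‖²`. -/
theorem norm_loadings_sq_le (h : ModelBounds P n p K B S0 f ε F Y C σ₁ σ₂) :
    ‖B‖ ^ 2 ≤ C / σ₁ * p := by
  have h1 := norm_sq_mul_le_of_quadGE h.quadGE_factors B
  have h2 : (B * covMat P f * B.transpose).trace ≤ ∑ i, ∫ ω, returns B f ε ω i ^ 2 ∂P := by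
    rw [Matrix.trace]
    refine Finset.sum_le_sum fun i _ => ?_
    have e : (B * covMat P f * B.transpose).diag i
        = Var[fun ω => returns B f ε ω i; P] - S0 i i := by
      rw [← covariance_self (h.memLp_returns i).aemeasurable]
      have := congrFun (congrFun h.covMat_returns i) i
      rw [covMat, Matrix.of_apply, Matrix.add_apply] at this
      rw [this, Matrix.diag_apply]
      ring
    have hS : 0 ≤ S0 i i := by
      rw [← h.integral_error_mul_error]
      exact integral_nonneg fun ω => mul_self_nonneg _
    rw [e]
    have := variance_le_expectation_sq (h.memLp_returns i).aestronglyMeasurable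
    simp only [Pi.pow_apply] at this
    linarith
  have h3 := h.sum_integral_returns_sq_le
  rw [div_mul_eq_mul_div, le_div_iff₀ h.σ₁_pos]
  linarith

theorem sum_factor_sq_le (h : ModelBounds P n p K B S0 f ε F Y C σ₁ σ₂) :
    ∑ k, ∫ ω, f ω k ^ 2 ∂P ≤ C * K := by
  refine (Finset.sum_le_sum fun k _ => (h.factor_moment k).2).trans_eq ?_
  simp [mul_comm]

theorem norm_loadings_le (h : ModelBounds P n p K B S0 f ε F Y C σ₁ σ₂) :
    ‖B‖ ≤ C / σ₁ * p := by
  have hC := h.one_le_C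
  have hp : (1 : ℝ) ≤ p := by exact_mod_cast h.one_le_p
  have hR : 1 ≤ C / σ₁ := by rw [le_div_iff₀ h.σ₁_pos]; linarith [h.σ₁_le_one]
  have h1 : 1 ≤ C / σ₁ * p := one_le_mul_of_one_le_of_one_le hR hp
  exact le_of_sq_le_sq (h.norm_loadings_sq_le.trans (le_self_pow₀ h1 two_ne_zero)) (by linarith)

theorem norm_covMat_factors_le (h : ModelBounds P n p K B S0 f ε F Y C σ₁ σ₂) :
    ‖covMat P f‖ ≤ 2 * (C * K) := by
  have hC := h.one_le_C
  refine norm_covMat_le (fun a => (h.factor_moment a).1) (fun a b => (h.factor_mul_factor a b).1)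
    (by positivity) h.sum_factor_sq_le (h.sum_factor_mul_factor_sq_le.trans ?_)
  nlinarith [sq_nonneg (K : ℝ)]

/-- The double sum is `‖y‖⁴`. Pointwise, `‖y‖² ≤ 2(‖B‖²‖f‖² + ‖ε‖²)`, and squaring produces the
constant 8. The same majorant gives the integrability of each product. -/
theorem returns_mul_returns (h : ModelBounds P n p K B S0 f ε F Y C σ₁ σ₂) :
    (∀ i j, MemLp (fun ω => returns B f ε ω i * returns B f ε ω j) 2 P) ∧
      ∑ i, ∑ j, ∫ ω, (returns B f ε ω i * returns B f ε ω j) ^ 2 ∂P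
        ≤ 8 * C * (‖B‖ ^ 4 * K ^ 2 + p ^ 2) := by
  set G : Ω → ℝ := fun ω => 8 * (‖B‖ ^ 4 * (∑ k, ∑ l, (f ω k * f ω l) ^ 2)
    + ∑ i, ∑ j, (ε ω i * ε ω j) ^ 2) with hG
  have i1 : Integrable (fun ω => ∑ k, ∑ l, (f ω k * f ω l) ^ 2) P :=
    integrable_finsetSum _ fun k _ => integrable_finsetSum _ fun l _ =>
      (h.factor_mul_factor k l).1.integrable_sq
  have i2 : Integrable (fun ω => ∑ i, ∑ j, (ε ω i * ε ω j) ^ 2) P :=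
    integrable_finsetSum _ fun k _ => integrable_finsetSum _ fun l _ =>
      (h.error_mul_error k l).1.integrable_sq
  have hGi : Integrable G P := ((i1.const_mul _).add i2).const_mul _
  have hsq : ∀ {d : ℕ} (u : Fin d → ℝ), ∑ i, ∑ j, (u i * u j) ^ 2 = (∑ i, u i ^ 2) ^ 2 := by
    intro d u
    rw [sq (∑ i, u i ^ 2), Finset.sum_mul_sum]
    simp only [mul_pow]
  have hpt : ∀ ω, ∑ i, ∑ j, (returns B f ε ω i * returns B f ε ω j) ^ 2 ≤ G ω := by
    intro ω
    simp only [hG]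
    rw [hsq, hsq, hsq]
    have hB : ∑ i, returns B f ε ω i ^ 2
        ≤ 2 * (‖B‖ ^ 2 * ∑ k, f ω k ^ 2 + ∑ i, ε ω i ^ 2) := by
      rw [frobenius_norm_sq, Finset.sum_mul, ← Finset.sum_add_distrib, Finset.mul_sum]
      refine Finset.sum_le_sum fun i _ => ?_
      have := Finset.sum_mul_sq_le_sq_mul_sq Finset.univ (fun k => B i k) (fun k => f ω k)
      rw [returns_apply]
      nlinarith [sq_nonneg (∑ k, B i k * f ω k - ε ω i)]
    have h0 : 0 ≤ ∑ i, returns B f ε ω i ^ 2 := Finset.sum_nonneg fun i _ => sq_nonneg _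
    calc _ ≤ (2 * (‖B‖ ^ 2 * ∑ k, f ω k ^ 2 + ∑ i, ε ω i ^ 2)) ^ 2 := by gcongr
      _ ≤ _ := by nlinarith [sq_nonneg (‖B‖ ^ 2 * ∑ k, f ω k ^ 2 - ∑ i, ε ω i ^ 2)]
  have hij : ∀ i j, MemLp (fun ω => returns B f ε ω i * returns B f ε ω j) 2 P := by
    intro i j
    have hm := (h.memLp_returns i).aestronglyMeasurable.mul (h.memLp_returns j).aestronglyMeasurable
    refine (memLp_two_iff_integrable_sq hm).2 (hGi.mono' (hm.pow 2)
      (Eventually.of_forall fun ω => ?_))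
    rw [Real.norm_of_nonneg (sq_nonneg _)]
    refine le_trans ?_ (hpt ω)
    refine le_trans ?_ (Finset.single_le_sum
      (f := fun i => ∑ j, (returns B f ε ω i * returns B f ε ω j) ^ 2)
      (fun i _ => Finset.sum_nonneg fun j _ => sq_nonneg _) (Finset.mem_univ i))
    exact Finset.single_le_sum (f := fun j => (returns B f ε ω i * returns B f ε ω j) ^ 2)
      (fun j _ => sq_nonneg _) (Finset.mem_univ j)
  refine ⟨hij, ?_⟩
  have hi : ∀ i, Integrable (fun ω => ∑ j, (returns B f ε ω i * returns B f ε ω j) ^ 2) P :=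
    fun i => integrable_finsetSum _ fun j _ => (hij i j).integrable_sq
  have e1 : ∑ i, ∑ j, ∫ ω, (returns B f ε ω i * returns B f ε ω j) ^ 2 ∂P
      = ∫ ω, ∑ i, ∑ j, (returns B f ε ω i * returns B f ε ω j) ^ 2 ∂P := by
    rw [integral_finsetSum _ fun i _ => hi i]
    exact Finset.sum_congr rfl fun i _ =>
      (integral_finsetSum _ fun j _ => (hij i j).integrable_sq).symm
  rw [e1]
  refine (integral_mono (integrable_finsetSum _ fun i _ => hi i) hGi hpt).trans ?_
  have e2 : ∫ ω, ∑ k, ∑ l, (f ω k * f ω l) ^ 2 ∂P ≤ C * K ^ 2 := by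
    rw [integral_finsetSum _ fun k _ => integrable_finsetSum _ fun l _ =>
      (h.factor_mul_factor k l).1.integrable_sq]
    simp only [integral_finsetSum _ fun l _ => (h.factor_mul_factor _ l).1.integrable_sq]
    exact h.sum_factor_mul_factor_sq_le
  have e3 : ∫ ω, ∑ i, ∑ j, (ε ω i * ε ω j) ^ 2 ∂P ≤ C * p ^ 2 := by
    rw [integral_finsetSum _ fun k _ => integrable_finsetSum _ fun l _ =>
      (h.error_mul_error k l).1.integrable_sq]
    simp only [integral_finsetSum _ fun l _ => (h.error_mul_error _ l).1.integrable_sq]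
    exact h.sum_error_mul_error_sq_le
  simp only [hG]
  rw [integral_const_mul, integral_add (i1.const_mul _) i2, integral_const_mul]
  have : ‖B‖ ^ 4 * ∫ ω, ∑ k, ∑ l, (f ω k * f ω l) ^ 2 ∂P ≤ ‖B‖ ^ 4 * (C * K ^ 2) := by gcongr
  linarith

end ModelBounds

end Model

end FactorCov

namespace FactorCov

/-! ### Bookkeeping of constants and powers of `p` and `K` -/

section Rates

attribute [local instance] Matrix.frobeniusNormedAddCommGroup Matrix.frobeniusNormedSpace

/-- The constant in the rate of convergence of the factor-model estimator. -/
noncomputable def factorRate (C σ₁ : ℝ) : ℝ :=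
  12 * C * (C / σ₁) + 28 * (4 / σ₁) * C ^ 2 * (C / σ₁) + 14 * (4 / σ₁) ^ 2 * C ^ 3 + C
    + 4 / σ₁ * C ^ 2

/-- In the application `H = s² / √n`, and the left side is the expansion of the factor-model error.
Each term is already at most a constant times `p² K H`; the further factor `K` is slack. -/
theorem factorRate_bound {b κ β α C σ p K H : ℝ} (hC : 1 ≤ C) (hR : 1 ≤ C / σ) (hρ : 0 < 4 / σ)
    (hp : 1 ≤ p) (hK : 1 ≤ K) (hH : 0 ≤ H) (hb : 0 ≤ b) (hb2 : b ^ 2 ≤ C / σ * p)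
    (hb1 : b ≤ C / σ * p) (hβ : β = 12 * C * (K * H)) (hκ0 : 0 ≤ κ) (hκ : κ ≤ 14 * (C * K))
    (_hα0 : 0 ≤ α) (hα : α ≤ C * p * H) (hα2 : α ^ 2 ≤ C ^ 2 * p ^ 2 * H) :
    b ^ 2 * β + 2 * (4 / σ * α) * κ * b + (4 / σ * α) ^ 2 * κ + α + 4 / σ * α * α
      ≤ factorRate C σ * (p ^ 2 * K ^ 2 * H) := by
  rw [factorRate]
  generalize C / σ = R at *
  generalize 4 / σ = ρ at *
  have hpp : p ≤ p ^ 2 := by nlinarith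
  have hKK : K ≤ K ^ 2 := by nlinarith
  have hK2 : 1 ≤ K ^ 2 := hK.trans hKK
  have t1 : b ^ 2 * β ≤ 12 * C * R * (p ^ 2 * K ^ 2 * H) := by
    calc b ^ 2 * β ≤ (R * p) * (12 * C * (K * H)) := by rw [hβ]; gcongr
      _ = 12 * C * R * (p * K * H) := by ring
      _ ≤ _ := by gcongr
  have t2 : 2 * (ρ * α) * κ * b ≤ 28 * ρ * C ^ 2 * R * (p ^ 2 * K ^ 2 * H) := by
    calc 2 * (ρ * α) * κ * b ≤ 2 * (ρ * (C * p * H)) * (14 * (C * K)) * (R * p) := by gcongr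
      _ = 28 * ρ * C ^ 2 * R * (p ^ 2 * K * H) := by ring
      _ ≤ _ := by gcongr
  have t3 : (ρ * α) ^ 2 * κ ≤ 14 * ρ ^ 2 * C ^ 3 * (p ^ 2 * K ^ 2 * H) := by
    calc (ρ * α) ^ 2 * κ = ρ ^ 2 * α ^ 2 * κ := by ring
      _ ≤ ρ ^ 2 * (C ^ 2 * p ^ 2 * H) * (14 * (C * K)) := by gcongr
      _ = 14 * ρ ^ 2 * C ^ 3 * (p ^ 2 * K * H) := by ring
      _ ≤ _ := by gcongr
  have t4 : α ≤ C * (p ^ 2 * K ^ 2 * H) := by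
    calc α ≤ C * (p * 1 * H) := by linarith
      _ ≤ _ := by gcongr
  have t5 : ρ * α * α ≤ ρ * C ^ 2 * (p ^ 2 * K ^ 2 * H) := by
    calc ρ * α * α = ρ * α ^ 2 := by ring
      _ ≤ ρ * (C ^ 2 * p ^ 2 * H) := by gcongr
      _ = ρ * C ^ 2 * (p ^ 2 * 1 * H) := by ring
      _ ≤ _ := by gcongr
  linarith

namespace ModelBounds

variable {Ω : Type*} [MeasurableSpace Ω] {P : Measure Ω} [IsProbabilityMeasure P] {n p K : ℕ}
  {B : Matrix (Fin p) (Fin K) ℝ} {S0 : Matrix (Fin p) (Fin p) ℝ}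
  {f : Ω → Fin K → ℝ} {ε : Ω → Fin p → ℝ}
  {F : Fin n → Ω → Fin K → ℝ} {Y : Fin n → Ω → Fin p → ℝ} {C σ₁ σ₂ : ℝ}

/-! ### Rates of convergence of the covariance estimators -/

theorem measureReal_sampleCov_factors (h : ModelBounds P n p K B S0 f ε F Y C σ₁ σ₂) (hn : 2 ≤ n)
    {s : ℝ} (hs : 1 ≤ s) :
    P.real {ω | 12 * s ^ 2 * (C * K) / √n < ‖sampleCov (dataMatrix F ω) - covMat P f‖}
      ≤ 2 / s ^ 2 := by
  have hC := h.one_le_C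
  have hK : (1 : ℝ) ≤ K := by exact_mod_cast h.one_le_K
  refine measureReal_norm_sampleCov_sub_gt_le hn h.indep h.identDistrib
    (z := fun x : (Fin K → ℝ) × (Fin p → ℝ) => x.1) measurable_fst
    (fun a => (h.factor_moment a).1) (fun a b => (h.factor_mul_factor a b).1) (by positivity) hs
    h.sum_factor_sq_le (h.sum_factor_mul_factor_sq_le.trans ?_)
  nlinarith [sq_nonneg (K : ℝ)]

theorem measureReal_sampleCov_returns (h : ModelBounds P n p K B S0 f ε F Y C σ₁ σ₂) (hn : 2 ≤ n)
    {s : ℝ} (hs : 1 ≤ s) :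
    P.real {ω | 12 * s ^ 2 * (4 * C * (C / σ₁) * (p * K)) / √n
      < ‖sampleCov (dataMatrix Y ω) - covMat P (returns B f ε)‖} ≤ 2 / s ^ 2 := by
  have hC := h.one_le_C
  have hσ := h.σ₁_pos
  have hK : (1 : ℝ) ≤ K := by exact_mod_cast h.one_le_K
  have hp : (1 : ℝ) ≤ p := by exact_mod_cast h.one_le_p
  have hR : 1 ≤ C / σ₁ := by rw [le_div_iff₀ hσ]; linarith [h.σ₁_le_one]
  obtain ⟨h1, h2⟩ := h.returns_mul_returns
  refine measureReal_norm_sampleCov_sub_gt_le hn h.indep h.identDistrib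
    (z := fun x : (Fin K → ℝ) × (Fin p → ℝ) => x.2) measurable_snd
    h.memLp_returns h1 (by positivity) hs
    (h.sum_integral_returns_sq_le.trans ?_) (h2.trans ?_)
  · have : (p : ℝ) ≤ p * K := le_mul_of_one_le_right (by positivity) hK
    have h3 : C ≤ 4 * C * (C / σ₁) := by nlinarith
    gcongr
  · have hB : ‖B‖ ^ 4 ≤ (C / σ₁ * p) ^ 2 := by
      calc ‖B‖ ^ 4 = (‖B‖ ^ 2) ^ 2 := by ring
        _ ≤ _ := by gcongr; exact h.norm_loadings_sq_le
    have h4 : (p : ℝ) ^ 2 ≤ (C / σ₁ * p) ^ 2 * K ^ 2 := by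
      rw [← mul_pow]
      have : (p : ℝ) ≤ C / σ₁ * p * K := by
        calc (p : ℝ) = 1 * p * 1 := by ring
          _ ≤ _ := by gcongr
      gcongr
    calc 8 * C * (‖B‖ ^ 4 * K ^ 2 + p ^ 2)
        ≤ 8 * C * ((C / σ₁ * p) ^ 2 * K ^ 2 + (C / σ₁ * p) ^ 2 * K ^ 2) := by gcongr
      _ = 16 * C * ((C / σ₁ * p) ^ 2 * K ^ 2) := by ring
      _ ≤ 16 * (C * C) * ((C / σ₁ * p) ^ 2 * K ^ 2) := by gcongr; nlinarith
      _ = _ := by ring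

/-- The sample consists of pairs `(F, Y)`, so the errors are recovered as the function `y - B f` of
a pair; the product with the factors has mean zero. -/
theorem measureReal_error_factor (h : ModelBounds P n p K B S0 f ε F Y C σ₁ σ₂) (hn : 1 ≤ n)
    {s : ℝ} (hs : 0 < s) :
    P.real {ω | s * (C * p) / √n < ‖(n : ℝ)⁻¹ • ((dataMatrix Y ω - B * dataMatrix F ω)
      * (dataMatrix F ω).transpose)‖} ≤ 1 / s ^ 2 := by
  have hC := h.one_le_C
  have hK : (1 : ℝ) ≤ K := by exact_mod_cast h.one_le_K
  have hp : (1 : ℝ) ≤ p := by exact_mod_cast h.one_le_p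
  have hKp : (K : ℝ) ≤ p := by exact_mod_cast h.K_le_p
  have hζ : ∀ ω i, returns B f ε ω i - ∑ j, B i j * f ω j = ε ω i := fun ω i => by
    rw [returns_apply]; ring
  have h1 := measureReal_norm_average_sub_gt_le hn h.indep h.identDistrib
    (W := fun x : (Fin K → ℝ) × (Fin p → ℝ) =>
      Matrix.of fun i k => (x.2 i - ∑ j, B i j * x.1 j) * x.1 k)
    (fun a b => by simp only [Matrix.of_apply]; fun_prop)
    (fun a b => by
      simp only [Matrix.of_apply, hζ]
      exact (h.error_mul_factor a b).1)
    (L := C * p) (by positivity) hs (by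
      simp only [Matrix.of_apply, hζ]
      refine h.sum_error_mul_factor_sq_le.trans ?_
      -- `K ≤ p` and `C ≥ 1` allow the simpler scale `C * p` in place of `√(C p K)`.
      calc C * (p * K) ≤ (C * C) * (p * p) := by gcongr; nlinarith
        _ = _ := by ring)
  simp only [Matrix.of_apply, hζ, h.integral_error_mul_factor] at h1
  refine (measureReal_mono fun ω hω => ?_).trans h1
  have e : (∑ i, Matrix.of fun a k => (Y i ω a - ∑ j, B a j * F i ω j) * F i ω k)
      = (dataMatrix Y ω - B * dataMatrix F ω) * (dataMatrix F ω).transpose := by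
    ext a b
    simp [Matrix.sum_apply, Matrix.mul_apply, dataMatrix]
  have e0 : (Matrix.of fun (_ : Fin p) (_ : Fin K) => (0 : ℝ)) = 0 := rfl
  simp only [Set.mem_ofPred_eq] at hω ⊢
  rw [e, e0, sub_zero]
  exact hω

theorem measureReal_error_error (h : ModelBounds P n p K B S0 f ε F Y C σ₁ σ₂) (hn : 1 ≤ n)
    {s : ℝ} (hs : 0 < s) :
    P.real {ω | s * (C * p) / √n < ‖(n : ℝ)⁻¹ • ((dataMatrix Y ω - B * dataMatrix F ω)
      * (dataMatrix Y ω - B * dataMatrix F ω).transpose) - S0‖} ≤ 1 / s ^ 2 := by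
  have hC := h.one_le_C
  have hp : (1 : ℝ) ≤ p := by exact_mod_cast h.one_le_p
  have hζ : ∀ ω i, returns B f ε ω i - ∑ j, B i j * f ω j = ε ω i := fun ω i => by
    rw [returns_apply]; ring
  have h1 := measureReal_norm_average_sub_gt_le hn h.indep h.identDistrib
    (W := fun x : (Fin K → ℝ) × (Fin p → ℝ) =>
      Matrix.of fun i k => (x.2 i - ∑ j, B i j * x.1 j) * (x.2 k - ∑ j, B k j * x.1 j))
    (fun a b => by simp only [Matrix.of_apply]; fun_prop)
    (fun a b => by
      simp only [Matrix.of_apply, hζ]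
      exact (h.error_mul_error a b).1)
    (L := C * p) (by positivity) hs (by
      simp only [Matrix.of_apply, hζ]
      refine h.sum_error_mul_error_sq_le.trans ?_
      calc C * (p : ℝ) ^ 2 ≤ (C * C) * p ^ 2 := by gcongr; nlinarith
        _ = _ := by ring)
  simp only [Matrix.of_apply, hζ, h.integral_error_mul_error] at h1
  refine (measureReal_mono fun ω hω => ?_).trans h1
  have e : (∑ i, Matrix.of fun a k => (Y i ω a - ∑ j, B a j * F i ω j) *
        (Y i ω k - ∑ j, B k j * F i ω j))
      = (dataMatrix Y ω - B * dataMatrix F ω) *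
        (dataMatrix Y ω - B * dataMatrix F ω).transpose := by
    ext a b
    rw [Matrix.sum_apply]
    rfl
  have e0 : (Matrix.of fun (a : Fin p) (b : Fin p) => S0 a b) = S0 := rfl
  simp only [Set.mem_ofPred_eq] at hω ⊢
  rw [e, e0]
  exact hω

/-- Off three bad events, of probabilities at most `2/s²`, `1/s²` and `1/s²`, the deterministic
expansion applies. The smallness hypothesis keeps the sample factor covariance within `σ₁ / 2` of
the truth and keeps its norm of order `K`. -/
theorem measureReal_sigmaHat (h : ModelBounds P n p K B S0 f ε F Y C σ₁ σ₂) (hn : 2 ≤ n)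
    {s : ℝ} (hs : 1 ≤ s) (hq : s ^ 2 * (p ^ 2 * K ^ 2 / √n) ≤ min 1 (σ₁ / (24 * C))) :
    P.real {ω | factorRate C σ₁ * (s ^ 2 * (p ^ 2 * K ^ 2 / √n))
      < ‖sigmaHat (dataMatrix F ω) (dataMatrix Y ω) - covMat P (returns B f ε)‖}
      ≤ 4 / s ^ 2 := by
  have hC := h.one_le_C
  have hσ := h.σ₁_pos
  have hK : (1 : ℝ) ≤ K := by exact_mod_cast h.one_le_K
  have hp : (1 : ℝ) ≤ p := by exact_mod_cast h.one_le_p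
  have hR : 1 ≤ C / σ₁ := by rw [le_div_iff₀ hσ]; linarith [h.σ₁_le_one]
  have hs0 : 0 < s := by linarith
  have hn1 : 1 ≤ n := by omega
  have hsn : 1 ≤ √(n : ℝ) := Real.one_le_sqrt.2 (by exact_mod_cast hn1)
  have hunion := (measureReal_union_le (μ := P) _ _).trans (add_le_add
    (h.measureReal_sampleCov_factors hn hs)
    ((measureReal_union_le (μ := P) _ _).trans (add_le_add
      (h.measureReal_error_factor hn1 hs0) (h.measureReal_error_error hn1 hs0))))
  refine (measureReal_mono fun ω hω => ?_).trans (hunion.trans_eq (by ring))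
  by_contra hcon
  simp only [Set.mem_union, Set.mem_ofPred_eq, not_or, not_lt] at hcon hω
  obtain ⟨c1, c2, c3⟩ := hcon
  refine absurd ?_ (not_le.2 hω)
  obtain ⟨H, hH⟩ : ∃ H, H = s ^ 2 / √(n : ℝ) := ⟨_, rfl⟩
  have hH0 : 0 < H := by rw [hH]; positivity
  have hq' : s ^ 2 * ((p : ℝ) ^ 2 * K ^ 2 / √n) = p ^ 2 * K ^ 2 * H := by rw [hH]; ring
  rw [hq'] at hq ⊢
  obtain ⟨hq1, hq2⟩ := le_min_iff.1 hq
  have hp2 : (1 : ℝ) ≤ p ^ 2 := one_le_pow₀ hp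
  have hpp : (p : ℝ) ≤ p ^ 2 := by nlinarith
  have hKK : (K : ℝ) ≤ K ^ 2 := by nlinarith
  have hK2 : (1 : ℝ) ≤ K ^ 2 := hK.trans hKK
  have hKH : K * H ≤ p ^ 2 * K ^ 2 * H := by
    calc K * H = 1 * K * H := by ring
      _ ≤ _ := by gcongr
  have hHle : H ≤ p ^ 2 * K ^ 2 * H := by
    calc H = 1 * 1 * H := by ring
      _ ≤ _ := by gcongr
  obtain ⟨β, hβ⟩ : ∃ β, β = 12 * s ^ 2 * (C * K) / √(n : ℝ) := ⟨_, rfl⟩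
  obtain ⟨α, hα⟩ : ∃ α, α = s * (C * p) / √(n : ℝ) := ⟨_, rfl⟩
  rw [← hβ] at c1
  rw [← hα] at c2 c3
  have hβH : β = 12 * C * (K * H) := by rw [hβ, hH]; ring
  have hα0 : 0 ≤ α := by rw [hα]; positivity
  have hαH : α ≤ C * p * H := by
    rw [hα, hH]
    calc s * (C * p) / √(n : ℝ) ≤ s ^ 2 * (C * p) / √n := by gcongr; nlinarith
      _ = _ := by ring
  have hα2 : α ^ 2 ≤ C ^ 2 * p ^ 2 * H := by
    rw [hα, hH]
    have : (1 : ℝ) / √n ^ 2 ≤ 1 / √n := by gcongr; nlinarith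
    calc (s * (C * p) / √(n : ℝ)) ^ 2 = C ^ 2 * p ^ 2 * s ^ 2 * (1 / √n ^ 2) := by ring
      _ ≤ C ^ 2 * p ^ 2 * s ^ 2 * (1 / √n) := by gcongr
      _ = _ := by ring
  have hβσ : β ≤ σ₁ / 2 := by
    rw [le_div_iff₀ (by positivity)] at hq2
    rw [hβH]
    nlinarith
  have key := norm_sigmaHat_sub_le hn (dataMatrix F ω) (dataMatrix Y ω) B (covMat P f) S0 h.diag
    hσ h.quadGE_factors c1 hβσ c2 c3
  rw [← h.covMat_returns] at key
  have hΦ := h.norm_covMat_factors_le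
  -- The constant is `14 = 2 + 12`, from `‖cov f‖ ≤ 2CK` and `H ≤ 1`.
  have hκ : ‖covMat P f‖ + β ≤ 14 * (C * K) := by
    have : C * (K * H) ≤ C * K := by
      gcongr
      exact mul_le_of_le_one_right (by positivity) (hHle.trans hq1)
    rw [hβH]; linarith
  have hκ0 : 0 ≤ ‖covMat P f‖ + β := add_nonneg (norm_nonneg _) ((norm_nonneg _).trans c1)
  have hB2 := h.norm_loadings_sq_le
  have hB := h.norm_loadings_le
  have hρ : α / (σ₁ / 4) = 4 / σ₁ * α := by field_simp
  have hρ0 : 0 < 4 / σ₁ := by positivity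
  rw [hρ] at key
  refine key.trans ?_
  exact factorRate_bound hC hR hρ0 hp hK hH0.le (norm_nonneg _) hB2 hB hβH hκ0 hκ hα0 hαH hα2

/-! ### Tightness of the estimated minimum variance -/

/-- Markov's inequality with `E‖Y‖² = n E‖y‖² ≤ n C p`; dividing by `p`, as the equally weighted
portfolio permits, makes the bound free of the dimension. -/
theorem measureReal_norm_dataMatrix (h : ModelBounds P n p K B S0 f ε F Y C σ₁ σ₂) (hn : 1 ≤ n)
    {t : ℝ} (ht : 0 < t) :
    P.real {ω | t < 3 / n * ‖dataMatrix Y ω‖ ^ 2 / p} ≤ 3 * C / t := by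
  have hp : (1 : ℝ) ≤ p := by exact_mod_cast h.one_le_p
  have hn0 : (0 : ℝ) < n := by positivity
  have hid : ∀ i a, IdentDistrib (fun ω => Y i ω a) (fun ω => returns B f ε ω a) P P := fun i a =>
    (h.identDistrib i).comp ((measurable_pi_apply a).comp measurable_snd)
  have hLp : ∀ i a, MemLp (fun ω => Y i ω a) 2 P := fun i a =>
    (hid i a).memLp_iff.2 (h.memLp_returns a)
  have hint : Integrable (fun ω => ‖dataMatrix Y ω‖ ^ 2) P := by
    simp only [frobenius_norm_sq]
    exact integrable_finsetSum _ fun a _ => integrable_finsetSum _ fun i _ =>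
      (hLp i a).integrable_sq
  have hE : ∫ ω, ‖dataMatrix Y ω‖ ^ 2 ∂P ≤ n * (C * p) := by
    simp only [frobenius_norm_sq]
    have hi : ∀ a i, Integrable (fun ω => dataMatrix Y ω a i ^ 2) P := fun a i =>
      (hLp i a).integrable_sq
    rw [integral_finsetSum _ fun a _ => integrable_finsetSum _ fun i _ => hi a i]
    calc ∑ a, ∫ ω, ∑ i, dataMatrix Y ω a i ^ 2 ∂P
        = ∑ a, n * ∫ ω, returns B f ε ω a ^ 2 ∂P := by
          refine Finset.sum_congr rfl fun a _ => ?_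
          rw [integral_finsetSum _ fun i _ => hi a i]
          have : ∀ i, ∫ ω, dataMatrix Y ω a i ^ 2 ∂P = ∫ ω, returns B f ε ω a ^ 2 ∂P := fun i =>
            ((hid i a).comp (measurable_id.pow_const 2)).integral_eq
          simp [this]
      _ ≤ n * (C * p) := by
          rw [← Finset.mul_sum]
          gcongr
          exact h.sum_integral_returns_sq_le
  have hM := mul_meas_ge_le_integral_of_nonneg (μ := P)
    (f := fun ω => 3 / n * ‖dataMatrix Y ω‖ ^ 2 / p)
    (Eventually.of_forall fun ω => by positivity) ((hint.const_mul _).div_const _) t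
  rw [integral_div, integral_const_mul] at hM
  rw [le_div_iff₀ ht, mul_comm]
  refine le_trans ?_ (hM.trans ?_)
  · refine mul_le_mul_of_nonneg_left (measureReal_mono fun ω hω => ?_) ht.le
    simp only [Set.mem_ofPred_eq] at hω ⊢
    exact hω.le
  · calc 3 / (n : ℝ) * (∫ ω, ‖dataMatrix Y ω‖ ^ 2 ∂P) / p ≤ 3 / n * (n * (C * p)) / p := by gcongr
      _ = 3 * C := by field_simp

/-- Any estimator of the covariance matrix whose norm is at most `3 n⁻¹ ‖Y‖²` has a bounded minimum
variance in probability. -/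
theorem measureReal_globalMinVar_sub (h : ModelBounds P n p K B S0 f ε F Y C σ₁ σ₂) (hn : 1 ≤ n)
    {T : Ω → Matrix (Fin p) (Fin p) ℝ} (hT : ∀ ω, (T ω).PosSemidef)
    (hTY : ∀ ω, ‖T ω‖ ≤ 3 / n * ‖dataMatrix Y ω‖ ^ 2) {c : ℝ} (hc : 0 < c)
    (hφ : c ≤ phi (covMat P (returns B f ε))) {t : ℝ} (ht : 0 < t) :
    P.real {ω | t < |globalMinVar (T ω) - globalMinVar (covMat P (returns B f ε))|}
      ≤ (3 * C + 1 / c) / t := by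
  have : NeZero p := ⟨by have := h.one_le_p; omega⟩
  have hC := h.one_le_C
  have hpd := h.quadGE_returns.posDef h.σ₂_pos (covMat_isHermitian P _)
  have hv0 := globalMinVar_nonneg hpd.posSemidef
  have hv : globalMinVar (covMat P (returns B f ε)) ≤ 1 / c := by
    rw [globalMinVar_eq_inv_phi _ hpd.det_pos.ne'.isUnit, ← one_div]
    exact one_div_le_one_div_of_le hc hφ
  -- For `t ≥ 1 / c` the true variance is at most `t`, so only a large estimated variance can cause
  -- the deviation. For smaller `t` the claimed bound exceeds 1.
  rcases le_or_gt (1 / c) t with htc | htc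
  · refine (measureReal_mono fun ω hω => ?_).trans ((h.measureReal_norm_dataMatrix hn ht).trans ?_)
    · simp only [Set.mem_ofPred_eq] at hω ⊢
      have h1 := globalMinVar_nonneg (hT ω)
      have h2 : globalMinVar (T ω) ≤ 3 / n * ‖dataMatrix Y ω‖ ^ 2 / p :=
        (globalMinVar_le_norm_div (hT ω)).trans (by gcongr; exact hTY ω)
      rcases lt_abs.1 hω with h3 | h3 <;> linarith
    · gcongr
      have : 0 < 1 / c := by positivity
      linarith
  · refine measureReal_le_one.trans ?_
    rw [le_div_iff₀ ht]
    linarith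

end ModelBounds

end Rates

end FactorCov

namespace FactorCov

section WeakConvergence

attribute [local instance] Matrix.frobeniusNormedAddCommGroup Matrix.frobeniusNormedSpace

/-! ### Weak convergence of the estimated minimum variance -/

/-- A tight sequence which is `O_P(q n)` as long as `q n` is small is `o_P(q n (log n)^{1/2})`. -/
theorem isLittleOP_of_rate {Ω : ℕ → Type*} [∀ n, MeasurableSpace (Ω n)]
    (P : ∀ n, Measure (Ω n)) [∀ n, IsProbabilityMeasure (P n)] (Z : ∀ n, Ω n → ℝ) {q : ℕ → ℝ}
    (hq : ∀ n, 0 ≤ q n) {A C₀ C₁ τ : ℝ} (hA : 0 ≤ A) (hC₁ : 0 ≤ C₁) (hτ : 0 < τ)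
    (htight : ∀ n, 2 ≤ n → ∀ t : ℝ, 0 < t → (P n).real {ω | t < |Z n ω|} ≤ A / t)
    (hrate : ∀ n, 2 ≤ n → ∀ s : ℝ, 1 ≤ s → s ^ 2 * q n ≤ τ →
      (P n).real {ω | C₀ * (s ^ 2 * q n) < |Z n ω|} ≤ C₁ / s ^ 2) :
    IsLittleOP P Z fun n => q n * √(Real.log n) := by
  intro δ hδ
  have hℓ : Tendsto (fun n : ℕ => √√(Real.log n)) atTop atTop :=
    Real.tendsto_sqrt_atTop.comp (Real.tendsto_sqrt_atTop.comp
      (Real.tendsto_log_atTop.comp tendsto_natCast_atTop_atTop))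
  have hlim : Tendsto (fun n : ℕ => (C₁ + A / (δ * τ)) / √√(Real.log n)) atTop (𝓝 0) :=
    hℓ.const_div_atTop _
  rw [← ENNReal.tendsto_toReal_iff (fun n => measure_ne_top _ _) ENNReal.zero_ne_top,
    ENNReal.toReal_zero]
  refine squeeze_zero' (Eventually.of_forall fun n => ENNReal.toReal_nonneg) ?_ hlim
  filter_upwards [eventually_ge_atTop 2, hℓ.eventually_ge_atTop 1,
    hℓ.eventually_ge_atTop (C₀ / δ)] with n hn h1 h2
  change (P n).real _ ≤ _
  -- Put `ℓ = (log n)^{1/4}`, so the threshold is `δ * q n * ℓ²`. One factor `ℓ` absorbs constants,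
  -- the other drives the probability to zero.
  have hsq : √√(Real.log n) ^ 2 = √(Real.log n) := Real.sq_sqrt (Real.sqrt_nonneg _)
  generalize √√(Real.log n) = ℓ at h1 h2 hsq ⊢
  rw [← hsq]
  have hℓ0 : 0 < ℓ := by linarith
  have hA' : 0 ≤ A / (δ * τ) := by positivity
  have hq0 := hq n
  rw [div_le_iff₀ hδ] at h2
  -- If `ℓ * q n ≤ τ`, the local rate applies with `s = √ℓ`, and `C₀ ≤ δ * ℓ` absorbs its constant.
  -- Otherwise the threshold exceeds `δ * τ * ℓ`, which diverges, and tightness suffices.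
  rcases le_or_gt (ℓ * q n) τ with hc | hc
  · have hs : √ℓ ^ 2 = ℓ := Real.sq_sqrt hℓ0.le
    have h3 := hrate n hn (√ℓ) (Real.one_le_sqrt.2 h1) (by rwa [hs])
    rw [hs] at h3
    refine (measureReal_mono fun ω hω => ?_).trans (h3.trans ?_)
    · simp only [Set.mem_ofPred_eq] at hω ⊢
      refine lt_of_le_of_lt ?_ hω
      calc C₀ * (ℓ * q n) ≤ ℓ * δ * (ℓ * q n) := by gcongr
        _ = δ * (q n * ℓ ^ 2) := by ring
    · gcongr
      linarith
  · refine (measureReal_mono fun ω hω => ?_).trans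
      ((htight n hn (δ * τ * ℓ) (by positivity)).trans ?_)
    · simp only [Set.mem_ofPred_eq] at hω ⊢
      refine lt_of_le_of_lt ?_ hω
      calc δ * τ * ℓ ≤ δ * (ℓ * q n) * ℓ := by gcongr
        _ = δ * (q n * ℓ ^ 2) := by ring
    · rw [← div_div]
      gcongr
      linarith

/-! ### From covariance estimators to minimum variances -/

theorem inv_pred_add_inv_le {n : ℕ} (hn : 2 ≤ n) :
    ((n : ℝ) - 1)⁻¹ ≤ 2 / n ∧ ((n : ℝ) - 1)⁻¹ + (n : ℝ)⁻¹ ≤ 3 / n := by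
  have h2 : (2 : ℝ) ≤ n := by exact_mod_cast hn
  have h : ((n : ℝ) - 1)⁻¹ ≤ 2 / n := by
    rw [inv_eq_one_div, div_le_div_iff₀ (by linarith) (by linarith)]; linarith
  refine ⟨h, ?_⟩
  calc ((n : ℝ) - 1)⁻¹ + (n : ℝ)⁻¹ ≤ 2 / n + (n : ℝ)⁻¹ := by gcongr
    _ = 3 / n := by ring

/-- A deviation of the minimum variance forces a deviation of the covariance estimator. -/
theorem measureReal_globalMinVar_sub_le_of_norm_sub {Ω : Type*} [MeasurableSpace Ω]
    {P : Measure Ω} [IsProbabilityMeasure P] {p : ℕ} [NeZero p]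
    {S : Matrix (Fin p) (Fin p) ℝ} {T : Ω → Matrix (Fin p) (Fin p) ℝ} {σ c η π : ℝ}
    (hσ : 0 < σ) (hc : 0 < c) (hS : S.IsHermitian) (hT : ∀ ω, (T ω).IsHermitian)
    (hSσ : QuadGE S σ) (hφ : c ≤ phi S) (hησ : η ≤ σ / 2)
    (h : P.real {ω | η < ‖T ω - S‖} ≤ π) :
    P.real {ω | 3 / (c * σ) * η < |globalMinVar (T ω) - globalMinVar S|} ≤ π := by
  refine (measureReal_mono fun ω hω => ?_).trans h
  simp only [Set.mem_ofPred_eq] at hω ⊢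
  by_contra hcon
  exact absurd (abs_globalMinVar_sub_le hσ hc hS (hT ω) hSσ hφ (not_lt.1 hcon) hησ)
    (not_le.2 hω)

theorem EigenvaluesGE.mono {d : ℕ} {S : Matrix (Fin d) (Fin d) ℝ} {σ σ' : ℝ}
    (h : EigenvaluesGE S σ) (hσ : σ' ≤ σ) : EigenvaluesGE S σ' :=
  fun t ht => hσ.trans (h t ht)

/-- One constant `C ≥ 1` serves for all moments and `σ₁` is lowered to at most 1, so that `C ≤ C²`
and `1 ≤ C / σ₁` can be used freely. -/
theorem exists_modelBounds {Ω : ℕ → Type*} [∀ n, MeasurableSpace (Ω n)]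
    {P : ∀ n, Measure (Ω n)} [∀ n, IsProbabilityMeasure (P n)]
    {p K : ℕ → ℕ} (hK : ∀ n, 1 ≤ K n)
    {B : ∀ n, Matrix (Fin (p n)) (Fin (K n)) ℝ}
    {S0 : ∀ n, Matrix (Fin (p n)) (Fin (p n)) ℝ}
    {f : ∀ n, Ω n → Fin (K n) → ℝ} {ε : ∀ n, Ω n → Fin (p n) → ℝ}
    {F : ∀ n, Fin n → Ω n → Fin (K n) → ℝ} {Y : ∀ n, Fin n → Ω n → Fin (p n) → ℝ}
    (hA : ∀ n, ConditionA (P n) n (p n) (K n) (B n) (S0 n) (f n) (ε n) (F n) (Y n))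
    (hB : ConditionB P p K B f ε) (hC : ConditionC p S0) :
    ∃ C σ₁ σ₂ : ℝ, ∀ n,
      ModelBounds (P n) n (p n) (K n) (B n) (S0 n) (f n) (ε n) (F n) (Y n) C σ₁ σ₂ := by
  obtain ⟨Cy, hy⟩ := hB.returns_moment
  obtain ⟨Cf, hf⟩ := hB.factors_moment
  obtain ⟨Ce, he⟩ := hB.errors_moment
  obtain ⟨σ₁, hσ₁, h1⟩ := hB.factors_cov
  obtain ⟨σ₂, hσ₂, h2⟩ := hC
  refine ⟨max 1 (max Cy (max Cf Ce)), min σ₁ 1, σ₂, fun n =>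
    { toConditionA := hA n
      one_le_K := hK n
      one_le_C := le_max_left _ _
      σ₁_pos := lt_min hσ₁ one_pos
      σ₂_pos := hσ₂
      σ₁_le_one := min_le_right _ _
      integral_returns_le := (hy n).2.trans ?_
      integrable_factors := fun i => (hf n i).1
      integral_factors_le := fun i => (hf n i).2.trans (by simp)
      integrable_errors := fun i => (he n i).1
      integral_errors_le := fun i => (he n i).2.trans (by simp)
      factors_cov := (h1 n).mono (min_le_left _ _)
      errors_cov := h2 n }⟩
  gcongr
  simp

end WeakConvergence

end FactorCov

/-- Weak convergence of the estimated global minimum variance, for the factor-model estimator and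
for the sample covariance matrix. -/
theorem theorem5
    {Ω : ℕ → Type*} [∀ n, MeasurableSpace (Ω n)]
    (P : ∀ n, Measure (Ω n)) [∀ n, IsProbabilityMeasure (P n)]
    (p K : ℕ → ℕ) (hK : ∀ n, 1 ≤ K n)
    (B : ∀ n, Matrix (Fin (p n)) (Fin (K n)) ℝ)
    (S0 : ∀ n, Matrix (Fin (p n)) (Fin (p n)) ℝ)
    (f : ∀ n, Ω n → Fin (K n) → ℝ) (ε : ∀ n, Ω n → Fin (p n) → ℝ)
    (F : ∀ n, Fin n → Ω n → Fin (K n) → ℝ) (Y : ∀ n, Fin n → Ω n → Fin (p n) → ℝ)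
    (hA : ∀ n, FactorCov.ConditionA (P n) n (p n) (K n) (B n) (S0 n) (f n) (ε n) (F n) (Y n))
    (hB : FactorCov.ConditionB P p K B f ε)
    (hC : FactorCov.ConditionC p S0)
    (hphi : ∃ c : ℝ, 0 < c ∧
      ∀ n, c ≤ FactorCov.phi (FactorCov.covMat (P n) (FactorCov.returns (B n) (f n) (ε n)))) :
    FactorCov.IsLittleOP P
      (fun n ω =>
        FactorCov.globalMinVar
            (FactorCov.sigmaHat (FactorCov.dataMatrix (F n) ω) (FactorCov.dataMatrix (Y n) ω))
          - FactorCov.globalMinVar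
            (FactorCov.covMat (P n) (FactorCov.returns (B n) (f n) (ε n))))
      (fun n => Real.sqrt ((p n : ℝ) ^ 4 * (K n : ℝ) ^ 4 * Real.log n / n)) ∧
    FactorCov.IsLittleOP P
      (fun n ω =>
        FactorCov.globalMinVar (FactorCov.sampleCov (FactorCov.dataMatrix (Y n) ω))
          - FactorCov.globalMinVar
            (FactorCov.covMat (P n) (FactorCov.returns (B n) (f n) (ε n))))
      (fun n => Real.sqrt ((p n : ℝ) ^ 6 * (K n : ℝ) ^ 2 * Real.log n / n)) := by
  obtain ⟨C, σ₁, σ₂, hM⟩ := FactorCov.exists_modelBounds hK hA hB hC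
  obtain ⟨c, hc, hφ⟩ := hphi
  have hC1 : 1 ≤ C := (hM 0).one_le_C
  have hσ₁ : 0 < σ₁ := (hM 0).σ₁_pos
  have hσ₂ : 0 < σ₂ := (hM 0).σ₂_pos
  have hp : ∀ n, NeZero (p n) := fun n => ⟨by have := (hM n).one_le_p; omega⟩
  have hS := fun n => FactorCov.covMat_isHermitian (P n) (FactorCov.returns (B n) (f n) (ε n))
  constructor
  · have hD : 0 < FactorCov.factorRate C σ₁ := by unfold FactorCov.factorRate; positivity
    have hr : (fun n : ℕ => √((p n : ℝ) ^ 4 * (K n : ℝ) ^ 4 * Real.log n / n))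
        = fun n : ℕ => (p n : ℝ) ^ 2 * (K n : ℝ) ^ 2 / √n * √(Real.log n) := by
      ext n
      rw [show (p n : ℝ) ^ 4 * (K n : ℝ) ^ 4 * Real.log n / n
          = ((p n : ℝ) ^ 2 * (K n : ℝ) ^ 2) ^ 2 * (Real.log n / n) by ring,
        Real.sqrt_mul (by positivity), Real.sqrt_sq (by positivity),
        Real.sqrt_div' _ (by positivity)]
      ring
    rw [hr]
    -- The first part of `τ` validates the rate for the factor estimator; the second keeps the
    -- covariance error below `σ₂ / 2`, where the minimum variance is Lipschitz with constant `3 /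
    -- (c * σ₂)`.
    refine FactorCov.isLittleOP_of_rate P _ (fun n => by positivity) (A := 3 * C + 1 / c)
      (C₀ := 3 / (c * σ₂) * FactorCov.factorRate C σ₁) (C₁ := 4)
      (τ := min (min 1 (σ₁ / (24 * C))) (σ₂ / (2 * FactorCov.factorRate C σ₁))) (by positivity)
      (by norm_num) (by positivity) ?_ ?_
    · intro n hn t ht
      have hn1 : 1 ≤ n := by omega
      refine (hM n).measureReal_globalMinVar_sub hn1
        (fun ω => FactorCov.sigmaHat_posSemidef hn1 _ _) (fun ω => ?_) hc (hφ n) ht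
      refine (FactorCov.norm_sigmaHat_le hn _ _).trans ?_
      gcongr
      exact (FactorCov.inv_pred_add_inv_le hn).2
    · intro n hn s hs hq
      obtain ⟨hq1, hq2⟩ := le_min_iff.1 hq
      rw [mul_assoc]
      refine FactorCov.measureReal_globalMinVar_sub_le_of_norm_sub hσ₂ hc (hS n)
        (fun ω => (FactorCov.sigmaHat_posSemidef (by omega) _ _).isHermitian)
        (hM n).quadGE_returns (hφ n) ?_ ((hM n).measureReal_sigmaHat hn hs hq1)
      rw [le_div_iff₀ (by positivity)] at hq2
      linarith
  · have hr : (fun n : ℕ => √((p n : ℝ) ^ 6 * (K n : ℝ) ^ 2 * Real.log n / n))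
        = fun n : ℕ => (p n : ℝ) ^ 3 * (K n : ℝ) / √n * √(Real.log n) := by
      ext n
      rw [show (p n : ℝ) ^ 6 * (K n : ℝ) ^ 2 * Real.log n / n
          = ((p n : ℝ) ^ 3 * (K n : ℝ)) ^ 2 * (Real.log n / n) by ring,
        Real.sqrt_mul (by positivity), Real.sqrt_sq (by positivity),
        Real.sqrt_div' _ (by positivity)]
      ring
    rw [hr]
    have hD : 0 < 48 * C * (C / σ₁) := by positivity
    refine FactorCov.isLittleOP_of_rate P _ (fun n => by positivity) (A := 3 * C + 1 / c)
      (C₀ := 3 / (c * σ₂) * (48 * C * (C / σ₁))) (C₁ := 2)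
      (τ := σ₂ / (2 * (48 * C * (C / σ₁)))) (by positivity)
      (by norm_num) (by positivity) ?_ ?_
    · intro n hn t ht
      have hn1 : 1 ≤ n := by omega
      refine (hM n).measureReal_globalMinVar_sub hn1
        (fun ω => FactorCov.sampleCov_posSemidef hn1 _) (fun ω => ?_) hc (hφ n) ht
      refine (FactorCov.norm_sampleCov_le hn _).trans ?_
      gcongr
      exact (FactorCov.inv_pred_add_inv_le hn).1.trans (by gcongr; norm_num)
    · intro n hn s hs hq
      have hp1 : (1 : ℝ) ≤ p n := by exact_mod_cast (hM n).one_le_p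
      rw [mul_assoc]
      refine FactorCov.measureReal_globalMinVar_sub_le_of_norm_sub hσ₂ hc (hS n)
        (fun ω => FactorCov.sampleCov_isHermitian _)
        (hM n).quadGE_returns (hφ n) ?_
        ((measureReal_mono fun ω hω => ?_).trans ((hM n).measureReal_sampleCov_returns hn hs))
      · rw [le_div_iff₀ (by positivity)] at hq
        linarith
      · simp only [Set.mem_ofPred_eq] at hω ⊢
        refine lt_of_le_of_lt ?_ hω
        have hpp : (p n : ℝ) ≤ (p n : ℝ) ^ 3 := le_self_pow₀ hp1 (by norm_num)
        calc 12 * s ^ 2 * (4 * C * (C / σ₁) * (p n * K n)) / √(n : ℝ)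
            = 48 * C * (C / σ₁) * (s ^ 2 * (p n * K n / √n)) := by ring
          _ ≤ _ := by gcongr
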